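/- Notions. A $2$-globular set $X$ consists of sets $X_0,X_1,X_2$ and maps $s_1,t_1:X_1\to X_0$, $s_2,t_2:X_2\to X_1$ with $s_1s_2=s_1t_2$ and $t_1s_2=t_1t_2$ (equivalently, it is a presheaf on the category of globes $0\rightrightarrows 1\rightrightarrows 2$); a morphism is a triple of maps commuting with sources and targets. Let $2\text{-}\mathrm{Glob}$ be the category of $2$-globular sets, $2\text{-}\mathrm{Cat}$ the category of small strict $2$-categories and strict $2$-functors, and $U:2\text{-}\mathrm{Cat}\to 2\text{-}\mathrm{Glob}$ the forgetful functor. The free $2$-category $TX$ on a $2$-globular set $X$ has the $0$-cells of $X$ as objects, the finite paths of $1$-cells of $X$ as arrows, and as $2$-cells the $2$-pasting diagrams labelled in $X$, that is, finite horizontal sequences of finite, possibly empty, vertical paths of $2$-cells of $X$ between parallel $1$-cells of $X$; composition is concatenation. A $2$-pasting diagram is a finite (possibly empty) sequence $P=(k_1,\dots,k_n)$ of $1$-pasting diagrams, where a $1$-pasting diagram is a chain $\bullet\to\cdots\to\bullet$ and is given by its number $k_i\ge 0$ of arrows. It depicts the $2$-globular set $i_1(P)$ with $0$-cells $0,\dots,n$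 and, for $1\le i\le n$, a vertical chain of $k_i$ $2$-cells through $k_i+1$ parallel $1$-cells from $i-1$ to $i$. Let $pd(2)$ be the category of $2$-pasting diagrams whose morphisms $P\to Q$ are the morphisms of $2$-globular sets $i_1(P)\to i_1(Q)$, with inclusion $i_1:pd(2)\to 2\text{-}\mathrm{Glob}$. Let $fpd(2)$ be the category of the free $2$-categories $T(i_1(P))$ on $2$-pasting diagrams and all strict $2$-functors between them, with inclusion $i:fpd(2)\to 2\text{-}\mathrm{Cat}$. Let $l:pd(2)\to fpd(2)$ send $P$ to $T(i_1(P))$ and $\varphi$ to $T(\varphi)$, and let $l^*$ denote restriction of presheaves along $l$. The nerve $2\text{-}\mathrm{Cat}(i,1)$ sends a $2$-category $\mathcal C$ to the presheaf $2\text{-}\mathrm{Cat}(i(-),\mathcal C)$ on $fpd(2)$; likewise $2\text{-}\mathrm{Glob}(i_1,G)$ denotes the presheaf $2\text{-}\mathrm{Glob}(i_1(-),G)$ on $pd(2)$. Theorem (a Segal condition for $2$-categories). 1. $T$ is left adjoint to $U$, the unit being the inclusion of the cells of $X$ in $TX$ as paths and pasting diagrams consisting of one cell; and the square $T\circ i_1=i\circ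 l$ commutes. 2. The functor $i$ is fully faithful and dense, and the nerve functor $2\text{-}\mathrm{Cat}(i,1):2\text{-}\mathrm{Cat}\to\widehat{fpd(2)}$ is fully faithful. 3. A presheaf $X$ on $fpd(2)$ is isomorphic to the nerve of a $2$-category if and only if there is a $2$-globular set $G$ such that $l^*X\cong 2\text{-}\mathrm{Glob}(i_1,G)$. -/

import Mathlib

open CategoryTheory

universe u

/-! ### 2-globular sets -/

/-- A 2-globular set, that is, a presheaf of sets on the category
`0 ⇉ 1 ⇉ 2` of globes: sets of 0-, 1- and 2-cells, with source and target maps such that the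
source and the target of a 2-cell are parallel. -/
structure TwoGlob : Type (u + 1) where
  /-- the 0-cells -/
  C0 : Type u
  /-- the 1-cells -/
  C1 : Type u
  /-- the 2-cells -/
  C2 : Type u
  s₁ : C1 → C0
  t₁ : C1 → C0
  s₂ : C2 → C1
  t₂ : C2 → C1
  s₁_s₂ : ∀ α, s₁ (s₂ α) = s₁ (t₂ α)
  t₁_t₂ : ∀ α, t₁ (s₂ α) = t₁ (t₂ α)

namespace TwoGlob

/-- A morphism of 2-globular sets: maps on cells that commute with sources and targets. -/
@[ext]
structure Hom (X Y : TwoGlob.{u}) : Type u where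
  f0 : X.C0 → Y.C0
  f1 : X.C1 → Y.C1
  f2 : X.C2 → Y.C2
  s₁_f1 : ∀ e, Y.s₁ (f1 e) = f0 (X.s₁ e)
  t₁_f1 : ∀ e, Y.t₁ (f1 e) = f0 (X.t₁ e)
  s₂_f2 : ∀ α, Y.s₂ (f2 α) = f1 (X.s₂ α)
  t₂_f2 : ∀ α, Y.t₂ (f2 α) = f1 (X.t₂ α)

/-- The category `2-Glob`. -/
instance : Category.{u} TwoGlob.{u} where
  Hom := Hom
  id X := ⟨id, id, id, fun _ => rfl, fun _ => rfl, fun _ => rfl, fun _ => rfl⟩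
  comp φ ψ :=
    { f0 := ψ.f0 ∘ φ.f0
      f1 := ψ.f1 ∘ φ.f1
      f2 := ψ.f2 ∘ φ.f2
      s₁_f1 := fun e => by simp [ψ.s₁_f1, φ.s₁_f1]
      t₁_f1 := fun e => by simp [ψ.t₁_f1, φ.t₁_f1]
      s₂_f2 := fun e => by simp [ψ.s₂_f2, φ.s₂_f2]
      t₂_f2 := fun e => by simp [ψ.t₂_f2, φ.t₂_f2] }

end TwoGlob

/-! ### 2-categories -/

/-- A small (strict) 2-category. -/
structure TwoCat : Type (u + 1) where
  carrier : Type u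
  [bicategory : Bicategory.{u, u} carrier]
  [strict : Bicategory.Strict carrier]

namespace TwoCat

instance : CoeSort TwoCat.{u} (Type u) := ⟨TwoCat.carrier⟩

instance (C : TwoCat.{u}) : Bicategory.{u, u} C := C.bicategory

instance (C : TwoCat.{u}) : Bicategory.Strict C := C.strict

/-- A strict pseudofunctor is determined by its action on cells. -/
theorem strictPseudofunctor_ext {B C : Type u} [Bicategory.{u, u} B] [Bicategory.{u, u} C]
    {F G : StrictPseudofunctor B C} (h : F.toPrelaxFunctor = G.toPrelaxFunctor) : F = G := by
  obtain ⟨⟨⟨F, mi, mc, _, _, _, _, _⟩, hi, hi'⟩, hc, hc'⟩ := F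
  obtain ⟨⟨⟨G, ni, nc, _, _, _, _, _⟩, ki, ki'⟩, kc, kc'⟩ := G
  dsimp at h hi hi' hc hc' ki ki' kc kc'
  subst h
  obtain rfl : mi = ni := by
    funext a
    rw [hi', ki']
  obtain rfl : @mc = @nc := by
    funext a b c f g
    rw [hc', kc']
  rfl

/-- The category `2-Cat` of small 2-categories and (strict) 2-functors. -/
instance : Category.{u} TwoCat.{u} where
  Hom C D := StrictPseudofunctor C D
  id C := StrictPseudofunctor.id C
  comp F G := StrictPseudofunctor.comp F G
  id_comp _ := strictPseudofunctor_ext rfl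
  comp_id _ := strictPseudofunctor_ext rfl
  assoc _ _ _ := strictPseudofunctor_ext rfl

/-- The 2-globular set of all cells of a 2-category. -/
def glob (C : TwoCat.{u}) : TwoGlob.{u} where
  C0 := C
  C1 := Σ a b : C, a ⟶ b
  C2 := Σ (a b : C) (f g : a ⟶ b), f ⟶ g
  s₁ f := f.1
  t₁ f := f.2.1
  s₂ α := ⟨α.1, α.2.1, α.2.2.1⟩
  t₂ α := ⟨α.1, α.2.1, α.2.2.2.1⟩
  s₁_s₂ _ := rfl
  t₁_t₂ _ := rfl

/-- The forgetful functor from 2-categories to 2-globular sets. -/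
def forget : TwoCat.{u} ⥤ TwoGlob.{u} where
  obj := glob
  map {C D} F :=
    let F' : StrictPseudofunctor C D := F
    { f0 := fun a => F'.obj a
      f1 := fun f => ⟨_, _, F'.map f.2.2⟩
      f2 := fun α => ⟨_, _, _, _, F'.map₂ α.2.2.2.2⟩
      s₁_f1 := fun _ => rfl
      t₁_f1 := fun _ => rfl
      s₂_f2 := fun _ => rfl
      t₂_f2 := fun _ => rfl }

end TwoCat

/-! ### Pasting diagrams -/

/-- An `n`-pasting diagram: the only 0-pasting diagram is a point, and an `(n+1)`-pasting diagram
is a finite sequence of `n`-pasting diagrams. -/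
def PastingDiagram : ℕ → Type
  | 0 => Unit
  | n + 1 => List (PastingDiagram n)

namespace PastingDiagram

/-- The number of columns of a 2-pasting diagram. -/
def width (P : PastingDiagram 2) : ℕ := List.length P

/-- The number of 2-cells in the `i`-th column of a 2-pasting diagram: the `i`-th entry is a
1-pasting diagram `• → ⋯ → •`, with this number of arrows. -/
def height (P : PastingDiagram 2) (i : Fin P.width) : ℕ :=
  List.length (α := PastingDiagram 0) (List.get (α := PastingDiagram 1) P i)

/-- The 2-globular set depicted by a 2-pasting diagram `P` of width `n` with heights `k i`: the
0-cells are `0, …, n`, and for each `i < n` there are `k i + 1` parallel 1-cells `(i, 0), …,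
(i, k i)` from `i` to `i + 1` and 2-cells `(i, j) ⟶ (i, j + 1)` for `j < k i`. -/
def toGlob (P : PastingDiagram 2) : TwoGlob.{u} where
  C0 := ULift (Fin (P.width + 1))
  C1 := ULift (Σ i : Fin P.width, Fin (P.height i + 1))
  C2 := ULift (Σ i : Fin P.width, Fin (P.height i))
  s₁ e := ⟨e.down.1.castSucc⟩
  t₁ e := ⟨e.down.1.succ⟩
  s₂ α := ⟨α.down.1, α.down.2.castSucc⟩
  t₂ α := ⟨α.down.1, α.down.2.succ⟩
  s₁_s₂ _ := rfl
  t₁_t₂ _ := rfl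

end PastingDiagram

/-! ### The free 2-category on a 2-globular set -/

namespace TwoGlob

/-- The 0-cells of a 2-globular set, as the vertices of the graph of its 1-cells. -/
def Vert (X : TwoGlob.{u}) : Type u := X.C0

/-- An arrow `a ⟶ b` is a 1-cell with source `a` and target `b`. -/
instance (X : TwoGlob.{u}) : Quiver.{u} X.Vert where
  Hom a b := { e : X.C1 // X.s₁ e = a ∧ X.t₁ e = b }

/-- An arrow `f ⟶ g` between parallel 1-cells is a 2-cell with source `f` and target `g`. -/
instance (X : TwoGlob.{u}) (a b : X.Vert) : Quiver.{u} (a ⟶ b) where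
  Hom f g := { α : X.C2 // X.s₂ α = f.1 ∧ X.t₂ α = g.1 }

open Quiver (Path)

/-- The 2-cells of the free 2-category between two paths of 1-cells of `X`, which are the
pasting diagrams labelled in `X`: sequences of vertical paths of 2-cells, composed
horizontally. A vertical path of length zero is the identity of a 1-cell. -/
inductive Cell {X : TwoGlob.{u}} {a : X.Vert} : {b : X.Vert} → Path a b → Path a b → Type u
  | nil : Cell Path.nil Path.nil
  | cons {b c : X.Vert} {p q : Path a b} {f g : b ⟶ c} (η : Cell p q) (v : Path f g) :
      Cell (p.cons f) (q.cons g)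

namespace Cell

variable {X : TwoGlob.{u}}

/-- The identity 2-cell of a path. -/
def id {a : X.Vert} : {b : X.Vert} → (p : Path a b) → Cell p p
  | _, .nil => nil
  | _, .cons p _ => cons (id p) .nil

/-- Vertical composition. -/
def vcomp {a : X.Vert} : {b : X.Vert} → {p q r : Path a b} → Cell p q → Cell q r → Cell p r
  | _, _, _, _, nil, nil => nil
  | _, _, _, _, cons η v, cons θ w => cons (vcomp η θ) (v.comp w)

/-- Horizontal composition with a path on the left. -/
def whiskerLeft {a b : X.Vert} (p : Path a b) :
    {c : X.Vert} → {q r : Path b c} → Cell q r → Cell (p.comp q) (p.comp r)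
  | _, _, _, nil => id p
  | _, _, _, cons η v => cons (whiskerLeft p η) v

/-- Horizontal composition with a path on the right. -/
def whiskerRight {a b : X.Vert} {p q : Path a b} (η : Cell p q) :
    {c : X.Vert} → (r : Path b c) → Cell (p.comp r) (q.comp r)
  | _, .nil => η
  | _, .cons r _ => cons (whiskerRight η r) .nil

theorem id_vcomp {a b : X.Vert} {p q : Path a b} (η : Cell p q) : vcomp (id p) η = η := by
  induction η with
  | nil => rfl
  | cons η v ih => simp [id, vcomp, ih]

theorem vcomp_id {a b : X.Vert} {p q : Path a b} (η : Cell p q) : vcomp η (id q) = η := by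
  induction η with
  | nil => rfl
  | cons η v ih => simp [id, vcomp, ih]

theorem vcomp_assoc {a b : X.Vert} {p q r s : Path a b} (η : Cell p q) (θ : Cell q r)
    (κ : Cell r s) : vcomp (vcomp η θ) κ = vcomp η (vcomp θ κ) := by
  induction η with
  | nil => cases θ; cases κ; rfl
  | cons η v ih => cases θ; cases κ; simp [vcomp, ih]

end Cell

/-- The objects of the free 2-category on `X`: the 0-cells of `X`. -/
def FreeObj (X : TwoGlob.{u}) : Type u := X.Vert

/-- The arrows of the free 2-category on `X` are the paths of 1-cells. -/
instance (X : TwoGlob.{u}) : CategoryStruct.{u} X.FreeObj where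
  Hom a b := @Quiver.Path X.Vert _ a b
  id a := @Quiver.Path.nil X.Vert _ a
  comp p q := Quiver.Path.comp p q

instance (X : TwoGlob.{u}) (a b : X.FreeObj) : Category.{u} (a ⟶ b) where
  Hom p q := @Cell X a b p q
  id p := Cell.id p
  comp η θ := Cell.vcomp η θ
  id_comp := Cell.id_vcomp
  comp_id := Cell.vcomp_id
  assoc := Cell.vcomp_assoc

namespace Cell

variable {X : TwoGlob.{u}}

theorem whiskerLeft_id {a b c : X.Vert} (p : Path a b) (q : Path b c) :
    whiskerLeft p (id q) = id (p.comp q) := by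
  induction q with
  | nil => rfl
  | cons q f ih => simp only [id, whiskerLeft, ih]; rfl

theorem whiskerLeft_vcomp {a b c : X.Vert} (p : Path a b) {q r s : Path b c}
    (η : Cell q r) (θ : Cell r s) :
    whiskerLeft p (vcomp η θ) = vcomp (whiskerLeft p η) (whiskerLeft p θ) := by
  induction η with
  | nil => cases θ; exact (id_vcomp _).symm
  | cons η v ih => cases θ; simp only [whiskerLeft, vcomp, ih]; rfl

theorem id_whiskerRight {a b c : X.Vert} (p : Path a b) (q : Path b c) :
    whiskerRight (id p) q = id (p.comp q) := by
  induction q with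
  | nil => rfl
  | cons q f ih => simp only [whiskerRight, ih]; rfl

theorem vcomp_whiskerRight {a b c : X.Vert} {p q r : Path a b}
    (η : Cell p q) (θ : Cell q r) (s : Path b c) :
    whiskerRight (vcomp η θ) s = vcomp (whiskerRight η s) (whiskerRight θ s) := by
  induction s with
  | nil => rfl
  | cons s f ih => simp only [whiskerRight, ih]; rfl

theorem whisker_exchange {a b c : X.Vert} {p q : Path a b} {r s : Path b c}
    (η : Cell p q) (θ : Cell r s) :
    vcomp (whiskerLeft p θ) (whiskerRight η s) =
      vcomp (whiskerRight η r) (whiskerLeft q θ) := by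
  induction θ with
  | nil => exact (id_vcomp _).trans (vcomp_id _).symm
  | cons θ v ih =>
    simp only [whiskerLeft, whiskerRight]
    change cons _ _ = cons _ _
    rw [ih]
    simp

theorem eq_eqToHom_comp {a b : X.FreeObj} {p p' q q' : a ⟶ b} (hp : p' = p) (hq : q = q')
    {η : p ⟶ q} {θ : p' ⟶ q'} (h : HEq θ η) : θ = eqToHom hp ≫ η ≫ eqToHom hq := by
  subst hp hq
  simpa using h

theorem cons_heq {a b c : X.Vert} {p q p' q' : Path a b} {f g : b ⟶ c} (hp : p = p') (hq : q = q')
    {η : Cell p q} {η' : Cell p' q'} (h : HEq η η') (v : Path f g) :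
    HEq (cons η v) (cons η' v) := by
  subst hp hq h
  rfl

theorem nil_whiskerLeft {a b : X.Vert} {p q : Path a b} (η : Cell p q) :
    HEq (whiskerLeft (Path.nil : Path a a) η) η := by
  induction η with
  | nil => rfl
  | cons η v ih => exact cons_heq (Path.nil_comp _) (Path.nil_comp _) (ih) v

theorem comp_whiskerLeft {a b c d : X.Vert} (p : Path a b) (q : Path b c) {r s : Path c d}
    (η : Cell r s) : HEq (whiskerLeft (p.comp q) η) (whiskerLeft p (whiskerLeft q η)) := by
  induction η with
  | nil => exact heq_of_eq (whiskerLeft_id p q).symm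
  | cons η v ih => exact cons_heq (Path.comp_assoc _ _ _) (Path.comp_assoc _ _ _) ih v

theorem whiskerRight_comp {a b c d : X.Vert} {p q : Path a b} (η : Cell p q) (r : Path b c)
    (s : Path c d) : HEq (whiskerRight η (r.comp s)) (whiskerRight (whiskerRight η r) s) := by
  induction s with
  | nil => rfl
  | cons s f ih =>
    exact cons_heq (Path.comp_assoc _ _ _).symm (Path.comp_assoc _ _ _).symm ih _

theorem whisker_assoc {a b c d : X.Vert} (p : Path a b) {q r : Path b c} (η : Cell q r)
    (s : Path c d) :
    HEq (whiskerRight (whiskerLeft p η) s) (whiskerLeft p (whiskerRight η s)) := by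
  induction s with
  | nil => rfl
  | cons s f ih => exact cons_heq (Path.comp_assoc _ _ _) (Path.comp_assoc _ _ _) ih _

end Cell

namespace Cell

variable {X : TwoGlob.{u}}

theorem whiskerLeft_eqToHom {a b c : X.FreeObj} (p : a ⟶ b) {q r : b ⟶ c} (e : q = r) :
    Cell.whiskerLeft p (eqToHom e) = eqToHom (congrArg (fun q => p ≫ q) e) := by
  subst e
  exact Cell.whiskerLeft_id p q

theorem eqToHom_whiskerRight {a b c : X.FreeObj} {p q : a ⟶ b} (e : p = q) (r : b ⟶ c) :
    Cell.whiskerRight (eqToHom e) r = eqToHom (congrArg (fun p => p ≫ r) e) := by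
  subst e
  exact Cell.id_whiskerRight p r

end Cell

theorem FreeObj.id_comp {X : TwoGlob.{u}} {a b : X.FreeObj} (p : a ⟶ b) : 𝟙 a ≫ p = p :=
  @Path.nil_comp X.Vert _ a b p

theorem FreeObj.comp_id {X : TwoGlob.{u}} {a b : X.FreeObj} (p : a ⟶ b) : p ≫ 𝟙 b = p :=
  rfl

theorem FreeObj.assoc {X : TwoGlob.{u}} {a b c d : X.FreeObj} (p : a ⟶ b) (q : b ⟶ c)
    (r : c ⟶ d) : (p ≫ q) ≫ r = p ≫ q ≫ r :=
  @Path.comp_assoc X.Vert _ a b c d p q r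

/-- The free 2-category on a 2-globular set, as a bicategory. -/
instance (X : TwoGlob.{u}) : Bicategory.{u, u} X.FreeObj where
  whiskerLeft p _ _ η := Cell.whiskerLeft p η
  whiskerRight η r := Cell.whiskerRight η r
  associator p q r := eqToIso (FreeObj.assoc p q r)
  leftUnitor p := eqToIso (FreeObj.id_comp p)
  rightUnitor p := eqToIso (FreeObj.comp_id p)
  whiskerLeft_id p q := Cell.whiskerLeft_id p q
  whiskerLeft_comp p _ _ _ η θ := Cell.whiskerLeft_vcomp p η θ
  id_whiskerLeft η :=
    Cell.eq_eqToHom_comp (FreeObj.id_comp _) (FreeObj.id_comp _).symm (Cell.nil_whiskerLeft η)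
  comp_whiskerLeft p q _ _ η :=
    Cell.eq_eqToHom_comp (FreeObj.assoc _ _ _) (FreeObj.assoc _ _ _).symm
      (Cell.comp_whiskerLeft p q η)
  id_whiskerRight p q := Cell.id_whiskerRight p q
  comp_whiskerRight η θ r := Cell.vcomp_whiskerRight η θ r
  whiskerRight_id η :=
    Cell.eq_eqToHom_comp (FreeObj.comp_id _) (FreeObj.comp_id _).symm HEq.rfl
  whiskerRight_comp η r s :=
    Cell.eq_eqToHom_comp (FreeObj.assoc _ _ _).symm (FreeObj.assoc _ _ _)
      (Cell.whiskerRight_comp η r s)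
  whisker_assoc p _ _ η s :=
    Cell.eq_eqToHom_comp (FreeObj.assoc _ _ _) (FreeObj.assoc _ _ _).symm
      (Cell.whisker_assoc p η s)
  whisker_exchange η θ := Cell.whisker_exchange η θ
  pentagon _ _ _ _ := by
    simp only [eqToIso.hom, Cell.whiskerLeft_eqToHom, Cell.eqToHom_whiskerRight, eqToHom_trans]
  triangle _ _ := by
    simp only [eqToIso.hom, Cell.whiskerLeft_eqToHom, Cell.eqToHom_whiskerRight, eqToHom_trans]

instance (X : TwoGlob.{u}) : Bicategory.Strict X.FreeObj where
  id_comp := FreeObj.id_comp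
  comp_id := FreeObj.comp_id
  assoc := FreeObj.assoc
  leftUnitor_eqToIso _ := rfl
  rightUnitor_eqToIso _ := rfl
  associator_eqToIso _ _ _ := rfl

/-- The action of a morphism of 2-globular sets on 0- and 1-cells, as a morphism of graphs. -/
def Hom.edgeMap {X Y : TwoGlob.{u}} (φ : Hom X Y) : X.Vert ⥤q Y.Vert where
  obj a := φ.f0 a
  map e := ⟨φ.f1 e.1, by rw [φ.s₁_f1, e.2.1], by rw [φ.t₁_f1, e.2.2]⟩

/-- The action of a morphism of 2-globular sets on parallel 1-cells and the 2-cells between them,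
as a morphism of graphs. -/
def Hom.faceMap {X Y : TwoGlob.{u}} (φ : Hom X Y) (a b : X.Vert) :
    (a ⟶ b) ⥤q (φ.edgeMap.obj a ⟶ φ.edgeMap.obj b) where
  obj e := φ.edgeMap.map e
  map α := ⟨φ.f2 α.1, by rw [φ.s₂_f2, α.2.1]; rfl, by rw [φ.t₂_f2, α.2.2]; rfl⟩

namespace Cell

variable {X Y Z : TwoGlob.{u}}

/-- The action of a morphism of 2-globular sets on the 2-cells of the free 2-categories. -/
def map (φ : Hom X Y) {a : X.Vert} : {b : X.Vert} → {p q : Path a b} → Cell p q →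
    Cell (φ.edgeMap.mapPath p) (φ.edgeMap.mapPath q)
  | _, _, _, nil => nil
  | _, _, _, cons η v => cons (map φ η) ((φ.faceMap _ _).mapPath v)

theorem map_id (φ : Hom X Y) {a b : X.Vert} (p : Path a b) :
    map φ (id p) = id (φ.edgeMap.mapPath p) := by
  induction p with
  | nil => rfl
  | cons p f ih => simp only [id, map, ih]; rfl

theorem map_vcomp (φ : Hom X Y) {a b : X.Vert} {p q r : Path a b} (η : Cell p q) (θ : Cell q r) :
    map φ (vcomp η θ) = vcomp (map φ η) (map φ θ) := by
  induction η with
  | nil => cases θ; rfl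
  | cons η v ih => 
    cases θ
    simp only [vcomp, map, ih, Prefunctor.mapPath_comp]
    rfl

theorem map_whiskerLeft (φ : Hom X Y) {a b c : X.Vert} (p : Path a b) {q r : Path b c}
    (η : Cell q r) : HEq (map φ (whiskerLeft p η)) (whiskerLeft (φ.edgeMap.mapPath p) (map φ η)) := by
  induction η with
  | nil => exact heq_of_eq (map_id φ p)
  | cons η v ih =>
    exact cons_heq (Prefunctor.mapPath_comp _ _ _) (Prefunctor.mapPath_comp _ _ _) ih _

theorem map_whiskerRight (φ : Hom X Y) {a b c : X.Vert} {p q : Path a b} (η : Cell p q)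
    (r : Path b c) :
    HEq (map φ (whiskerRight η r)) (whiskerRight (map φ η) (φ.edgeMap.mapPath r)) := by
  induction r with
  | nil => rfl
  | cons r f ih =>
    exact cons_heq (Prefunctor.mapPath_comp _ _ _) (Prefunctor.mapPath_comp _ _ _) ih _

theorem cons_heq' {a b c : X.Vert} {p q p' q' : Path a b} {f g f' g' : b ⟶ c}
    (hp : p = p') (hq : q = q') (hf : f = f') (hg : g = g')
    {η : Cell p q} {η' : Cell p' q'} (h : HEq η η') {v : Path f g} {v' : Path f' g'}
    (hv : HEq v v') : HEq (cons η v) (cons η' v') := by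
  subst hp hq hf hg h hv
  rfl

theorem map_id_hom {a b : X.Vert} {p q : Path a b} (η : Cell p q) :
    HEq (map (𝟙 X : X ⟶ X) η) η := by
  induction η with
  | nil => rfl
  | cons η v ih =>
    exact cons_heq' (Prefunctor.mapPath_id _) (Prefunctor.mapPath_id _) rfl rfl ih
      (heq_of_eq (Prefunctor.mapPath_id _))

theorem mapPath_comp_hom (φ : X ⟶ Y) (ψ : Y ⟶ Z) {a b : X.Vert} (p : Path a b) :
    (Hom.edgeMap (φ ≫ ψ)).mapPath p = (Hom.edgeMap ψ).mapPath ((Hom.edgeMap φ).mapPath p) :=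
  Prefunctor.mapPath_comp_apply (Hom.edgeMap φ) (Hom.edgeMap ψ) p

theorem map_comp_hom (φ : X ⟶ Y) (ψ : Y ⟶ Z) {a b : X.Vert} {p q : Path a b} (η : Cell p q) :
    HEq (map (φ ≫ ψ) η) (map ψ (map φ η)) := by
  induction η with
  | nil => rfl
  | cons η v ih =>
    exact cons_heq' (X := Z) (η := map (φ ≫ ψ) η) (mapPath_comp_hom φ ψ _)
      (mapPath_comp_hom φ ψ _) rfl rfl ih
      (heq_of_eq (Prefunctor.mapPath_comp_apply (φ.faceMap _ _) (ψ.faceMap _ _) v))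

end Cell

/-- The free 2-category on a 2-globular set. -/
def freeObj (X : TwoGlob.{u}) : TwoCat.{u} := ⟨X.FreeObj⟩

theorem mapPath_comp {X Y : TwoGlob.{u}} (φ : Hom X Y) {a b c : X.Vert} (p : Path a b)
    (q : Path b c) :
    φ.edgeMap.mapPath (p.comp q) = (φ.edgeMap.mapPath p).comp (φ.edgeMap.mapPath q) :=
  Prefunctor.mapPath_comp _ p q

/-- The 2-functor between free 2-categories induced by a morphism of 2-globular sets. -/
def freeMap {X Y : TwoGlob.{u}} (φ : Hom X Y) : StrictPseudofunctor X.FreeObj Y.FreeObj :=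
  StrictPseudofunctor.mk''
    { obj := φ.edgeMap.obj
      map := fun {a b} p => @Prefunctor.mapPath _ _ _ _ φ.edgeMap a b p
      map₂ := fun {a b p q} η => @Cell.map X Y φ a b p q η
      map₂_id := fun p => Cell.map_id φ p
      map₂_comp := fun η θ => Cell.map_vcomp φ η θ
      map_id := fun _ => rfl
      map_comp := fun p q => mapPath_comp φ p q
      map₂_whisker_left := fun p _ _ η =>
        Cell.eq_eqToHom_comp (mapPath_comp φ _ _) (mapPath_comp φ _ _).symm
          (Cell.map_whiskerLeft φ p η)
      map₂_whisker_right := fun η r =>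
        Cell.eq_eqToHom_comp (mapPath_comp φ _ _) (mapPath_comp φ _ _).symm
          (Cell.map_whiskerRight φ η r) }

theorem prelaxFunctor_ext {B C : Type u} [Bicategory.{u, u} B] [Bicategory.{u, u} C]
    (obj : B → C) (map map' : ∀ {a b : B}, (a ⟶ b) → (obj a ⟶ obj b))
    (map₂ : ∀ {a b : B} {f g : a ⟶ b}, (f ⟶ g) → (map f ⟶ map g))
    (map₂' : ∀ {a b : B} {f g : a ⟶ b}, (f ⟶ g) → (map' f ⟶ map' g))
    (h : ∀ {a b : B} (f : a ⟶ b), map f = map' f)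
    (h₂ : ∀ {a b : B} {f g : a ⟶ b} (η : f ⟶ g), HEq (map₂ η) (map₂' η)) (i j i' j') :
    (⟨⟨⟨obj, map⟩, map₂⟩, i, j⟩ : PrelaxFunctor B C) = ⟨⟨⟨obj, map'⟩, map₂'⟩, i', j'⟩ := by
  obtain rfl : @map = @map' := by
    funext a b f
    exact h f
  obtain rfl : @map₂ = @map₂' := by
    funext a b f g η
    exact eq_of_heq (h₂ η)
  rfl

/-- The free 2-category functor `2-Glob ⥤ 2-Cat`. -/
def free : TwoGlob.{u} ⥤ TwoCat.{u} where
  obj := freeObj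
  map φ := freeMap φ
  map_id X := TwoCat.strictPseudofunctor_ext <|
    prelaxFunctor_ext (B := X.FreeObj) (C := X.FreeObj) _ _ _ _ _
      (fun {a b} p => @Prefunctor.mapPath_id X.Vert _ a b p)
      (fun η => Cell.map_id_hom η) _ _ _ _
  map_comp {X _ Z} φ ψ := TwoCat.strictPseudofunctor_ext <|
    prelaxFunctor_ext (B := X.FreeObj) (C := Z.FreeObj) _ _ _ _ _
      (fun {a b} p => @Cell.mapPath_comp_hom X _ Z φ ψ a b p)
      (fun η => Cell.map_comp_hom φ ψ η) _ _ _ _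

/-- A 1-cell of `X`, as an arrow between its source and its target. -/
def edge {X : TwoGlob.{u}} (e : X.C1) {a b : X.Vert} (ha : X.s₁ e = a) (hb : X.t₁ e = b) :
    a ⟶ b := ⟨e, ha, hb⟩

/-- A 2-cell of `X`, as an arrow between its source and its target. -/
def face {X : TwoGlob.{u}} (α : X.C2) {a b : X.Vert} {f g : a ⟶ b} (hf : X.s₂ α = f.1)
    (hg : X.t₂ α = g.1) : f ⟶ g := ⟨α, hf, hg⟩

/-- The inclusion of the cells of a 2-globular set in its free 2-category, as paths and pasting
diagrams that consist of one cell. -/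
def inclusion (X : TwoGlob.{u}) : X ⟶ TwoCat.forget.obj (free.obj X) :=
  show Hom X (freeObj X).glob from
  { f0 := fun a => a
    f1 := fun e => ⟨X.s₁ e, X.t₁ e, (edge e rfl rfl).toPath⟩
    f2 := fun α => ⟨X.s₁ (X.s₂ α), X.t₁ (X.s₂ α), (edge (X.s₂ α) rfl rfl).toPath,
      (edge (X.t₂ α) (X.s₁_s₂ α).symm (X.t₁_t₂ α).symm).toPath,
      Cell.cons Cell.nil (face α rfl rfl).toPath⟩
    s₁_f1 := fun _ => rfl
    t₁_f1 := fun _ => rfl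
    s₂_f2 := fun _ => rfl
    t₂_f2 := fun α => by
      have h {a b : X.Vert} (e : X.C1) (ha : X.s₁ e = a) (hb : X.t₁ e = b) :
          (⟨a, b, (edge e ha hb).toPath⟩ : Σ a b : X.FreeObj, a ⟶ b) =
            ⟨X.s₁ e, X.t₁ e, (edge e rfl rfl).toPath⟩ := by
        subst ha hb
        rfl
      exact h _ _ _ }

end TwoGlob

/-! ### The nerve of a 2-category -/

/-- The category `pd(2)` of 2-pasting diagrams: a morphism is a morphism between the 2-globular
sets that they depict. -/
abbrev Pd2 : Type := InducedCategory TwoGlob.{u} PastingDiagram.toGlob.{u}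

/-- The category `fpd(2)` of free 2-categories on 2-pasting diagrams, with all 2-functors between
them. -/
abbrev Fpd2 : Type :=
  InducedCategory TwoCat.{u} (fun P : PastingDiagram 2 => TwoGlob.free.obj P.toGlob)

/-- The inclusion `i₁ : pd(2) ⥤ 2-Glob`. -/
abbrev pdInclusion : Pd2.{u} ⥤ TwoGlob.{u} := inducedFunctor _

/-- The inclusion `i : fpd(2) ⥤ 2-Cat`. -/
abbrev fpdInclusion : Fpd2.{u} ⥤ TwoCat.{u} := inducedFunctor _

/-- The functor `l : pd(2) ⥤ fpd(2)` that sends a 2-pasting diagram to the free 2-category on it. -/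
def pdToFpd : Pd2.{u} ⥤ Fpd2.{u} where
  obj P := P
  map φ := InducedCategory.homMk (TwoGlob.free.map φ.hom)
  map_id _ := InducedCategory.hom_ext (TwoGlob.free.map_id _)
  map_comp _ _ := InducedCategory.hom_ext (TwoGlob.free.map_comp _ _)

/-- The nerve functor `𝒟(j, 1)` along `j : Θ ⥤ 𝒟`, which sends an object `D` to the presheaf
`θ ↦ 𝒟(j θ, D)` on `Θ`. -/
abbrev nerveAlong {Θ : Type} [Category.{u} Θ] {𝒟 : Type (u + 1)} [Category.{u} 𝒟] (j : Θ ⥤ 𝒟) :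
    𝒟 ⥤ Θᵒᵖ ⥤ Type u :=
  yoneda ⋙ (Functor.whiskeringLeft _ _ _).obj j.op

/-- The nerve functor `2-Cat(i, 1)`. -/
abbrev twoNerve : TwoCat.{u} ⥤ Fpd2.{u}ᵒᵖ ⥤ Type u := nerveAlong fpdInclusion

/-- The nerve functor `2-Glob(i₁, 1)`. -/
abbrev globNerve : TwoGlob.{u} ⥤ Pd2.{u}ᵒᵖ ⥤ Type u := nerveAlong pdInclusion

/-! A strict 2-category amounts to a 2-globular set with identities, composites and whiskerings on
its cells (`Ops`) that satisfy equations (`Ops.Lawful`), and a 2-functor amounts to a globular map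
that preserves them (`Ops.IsHom`; `TwoCat.isHom_forget_map`, `TwoCat.exists_functor_of_isHom`).
Cells are untyped here and composability is a hypothesis, so the coherence isomorphisms of a strict
bicategory disappear from the equations.

The adjunction: a map from `X` to the cells of a 2-category extends to the free 2-category by
evaluating pasting diagrams (`extend`, `isHom_extend`). The extension is unique because the cells of
`X` generate (`hom_free_ext`).

The nerve: a cell of a globular set is a map from a globe, and globes are pasting diagrams. Hence a
natural family of maps on diagrams comes from a globular map (`exists_hom_of_diagrams`). The
arguments of every operation and the variables of every axiom also form a small pasting diagram, so
preservation of the operations and the axioms themselves can be checked on free 2-categories on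
diagrams (`Ops.isHom_of_cover`, `Ops.lawful_of_cover`). This makes the nerve functor fully faithful,
and density of `i` follows.

The Segal condition: the nerve of `C` restricts to the globular nerve of its cells by transposition
along the adjunction. Conversely, if `X` restricts to the nerve of `G`, a diagram `χ` in `G` of
shape `P` is an element of `X` at `P`. Restricting this element along 2-functors into the free
2-category on `P` evaluates every cell of the latter in `G`. These evaluations form an
`ArityAlgebra`. Its operations are those of the free 2-categories, carried to `G`; they are lawful,
and the nerve of the resulting 2-category is `X`. -/

namespace TwoGlob

/-! ### Globular sets with the operations of a 2-category -/

@[ext]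
theorem hom_ext {X Y : TwoGlob.{u}} {φ ψ : X ⟶ Y} (h0 : ∀ a, φ.f0 a = ψ.f0 a)
    (h1 : ∀ e, φ.f1 e = ψ.f1 e) (h2 : ∀ α, φ.f2 α = ψ.f2 α) : φ = ψ :=
  Hom.ext (funext h0) (funext h1) (funext h2)

/-- The operations of a 2-category on the cells of a 2-globular set, without typing of cells. -/
structure Ops (G : TwoGlob.{u}) where
  one : G.C0 → G.C1
  comp (f g : G.C1) (h : G.t₁ f = G.s₁ g) : G.C1
  one₂ : G.C1 → G.C2
  vcomp (α β : G.C2) (h : G.t₂ α = G.s₂ β) : G.C2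
  wl (f : G.C1) (α : G.C2) (h : G.t₁ f = G.s₁ (G.s₂ α)) : G.C2
  wr (α : G.C2) (g : G.C1) (h : G.t₁ (G.s₂ α) = G.s₁ g) : G.C2
  s₁_one (a) : G.s₁ (one a) = a
  t₁_one (a) : G.t₁ (one a) = a
  s₁_comp (f g h) : G.s₁ (comp f g h) = G.s₁ f
  t₁_comp (f g h) : G.t₁ (comp f g h) = G.t₁ g
  s₂_one₂ (f) : G.s₂ (one₂ f) = f
  t₂_one₂ (f) : G.t₂ (one₂ f) = f
  s₂_vcomp (α β h) : G.s₂ (vcomp α β h) = G.s₂ α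
  t₂_vcomp (α β h) : G.t₂ (vcomp α β h) = G.t₂ β
  s₂_wl (f α h) : G.s₂ (wl f α h) = comp f (G.s₂ α) h
  t₂_wl (f α h) : G.t₂ (wl f α h) = comp f (G.t₂ α) (h.trans (G.s₁_s₂ α))
  s₂_wr (α g h) : G.s₂ (wr α g h) = comp (G.s₂ α) g h
  t₂_wr (α g h) : G.t₂ (wr α g h) = comp (G.t₂ α) g ((G.t₁_t₂ α).symm.trans h)

namespace Ops

attribute [simp] s₁_one t₁_one s₁_comp t₁_comp s₂_one₂ t₂_one₂ s₂_vcomp t₂_vcomp s₂_wl t₂_wl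
  s₂_wr t₂_wr

section congr

variable {G : TwoGlob.{u}} (O : G.Ops) {f f' g g' : G.C1} {α α' β β' : G.C2}

/-- The operations take a proof of composability, which blocks plain rewriting of an argument; this
lemma and the next three carry that proof along. -/
theorem comp_congr (hf : f = f') (hg : g = g') (h) :
    O.comp f g h = O.comp f' g' (by rwa [← hf, ← hg]) := by
  subst hf hg
  rfl

theorem vcomp_congr (hα : α = α') (hβ : β = β') (h) :
    O.vcomp α β h = O.vcomp α' β' (by rwa [← hα, ← hβ]) := by
  subst hα hβ
  rfl

theorem wl_congr (hf : f = f') (hα : α = α') (h) :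
    O.wl f α h = O.wl f' α' (by rwa [← hf, ← hα]) := by
  subst hf hα
  rfl

theorem wr_congr (hα : α = α') (hf : f = f') (h) :
    O.wr α f h = O.wr α' f' (by rwa [← hf, ← hα]) := by
  subst hf hα
  rfl

end congr

/-- The axioms of a strict 2-category. -/
structure Lawful {G : TwoGlob.{u}} (O : G.Ops) : Prop where
  one_comp (a f h) : O.comp (O.one a) f h = f
  comp_one (f a h) : O.comp f (O.one a) h = f
  assoc (f g h h₁ h₂) : O.comp (O.comp f g h₁) h h₂ =
    O.comp f (O.comp g h (by simpa using h₂)) (by simpa using h₁)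
  one₂_vcomp (f α h) : O.vcomp (O.one₂ f) α h = α
  vcomp_one₂ (α f h) : O.vcomp α (O.one₂ f) h = α
  vassoc (α β γ h₁ h₂) : O.vcomp (O.vcomp α β h₁) γ h₂ =
    O.vcomp α (O.vcomp β γ (by simpa using h₂)) (by simpa using h₁)
  wl_one₂ (f g h) : O.wl f (O.one₂ g) h = O.one₂ (O.comp f g (by simpa using h))
  wl_vcomp (f α β h₁ h₂) : O.wl f (O.vcomp α β h₁) h₂ =
    O.vcomp (O.wl f α (by simpa using h₂))
      (O.wl f β (by simp only [s₂_vcomp] at h₂; rw [h₂, G.s₁_s₂, h₁]))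
      (by simp only [s₂_wl, t₂_wl, h₁])
  one_wl (a α h) : O.wl (O.one a) α h = α
  comp_wl (f g α h₁ h₂) : O.wl (O.comp f g h₁) α h₂ =
    O.wl f (O.wl g α (by simpa using h₂)) (by simpa using h₁)
  one₂_wr (f g h) : O.wr (O.one₂ f) g h = O.one₂ (O.comp f g (by simpa using h))
  vcomp_wr (α β g h₁ h₂) : O.wr (O.vcomp α β h₁) g h₂ =
    O.vcomp (O.wr α g (by simpa using h₂))
      (O.wr β g (by simp only [s₂_vcomp] at h₂; rw [← h₂, G.t₁_t₂ α, h₁]))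
      (by simp only [s₂_wr, t₂_wr, h₁])
  wr_one (α a h) : O.wr α (O.one a) h = α
  wr_comp (α f g h₁ h₂) : O.wr α (O.comp f g h₁) h₂ =
    O.wr (O.wr α f (by simpa using h₂)) g (by simpa using h₁)
  wl_wr (f α g h₁ h₂) : O.wr (O.wl f α h₁) g h₂ =
    O.wl f (O.wr α g (by simpa using h₂)) (by simpa using h₁)
  exchange (α β) (h : G.t₁ (G.s₂ α) = G.s₁ (G.s₂ β)) :
    O.vcomp (O.wl (G.s₂ α) β h) (O.wr α (G.t₂ β) (h.trans (G.s₁_s₂ β))) (by simp) =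
      O.vcomp (O.wr α (G.s₂ β) h) (O.wl (G.t₂ α) β ((G.t₁_t₂ α).symm.trans h)) (by simp)

/-- A morphism of 2-globular sets that preserves the operations of a 2-category. -/
structure IsHom {G H : TwoGlob.{u}} (O : G.Ops) (O' : H.Ops) (m : Hom G H) : Prop where
  one (a) : m.f1 (O.one a) = O'.one (m.f0 a)
  comp (f g h) : m.f1 (O.comp f g h) =
    O'.comp (m.f1 f) (m.f1 g) (by rw [m.t₁_f1, m.s₁_f1, h])
  one₂ (f) : m.f2 (O.one₂ f) = O'.one₂ (m.f1 f)
  vcomp (α β h) : m.f2 (O.vcomp α β h) =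
    O'.vcomp (m.f2 α) (m.f2 β) (by rw [m.t₂_f2, m.s₂_f2, h])
  wl (f α h) : m.f2 (O.wl f α h) =
    O'.wl (m.f1 f) (m.f2 α) (by rw [m.s₂_f2, m.t₁_f1, m.s₁_f1, h])
  wr (α g h) : m.f2 (O.wr α g h) =
    O'.wr (m.f2 α) (m.f1 g) (by rw [m.s₂_f2, m.t₁_f1, m.s₁_f1, h])

theorem IsHom.congr {G H : TwoGlob.{u}} {O : G.Ops} {O' : H.Ops} {m n : G ⟶ H}
    (hm : O.IsHom O' m) (h : m = n) : O.IsHom O' n := h ▸ hm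

theorem IsHom.trans {G H K : TwoGlob.{u}} {O : G.Ops} {O' : H.Ops} {O'' : K.Ops} {m : G ⟶ H}
    {n : H ⟶ K} (hm : O.IsHom O' m) (hn : O'.IsHom O'' n) : O.IsHom O'' (m ≫ n) where
  one a := (congrArg n.f1 (hm.one a)).trans (hn.one _)
  comp f g h := (congrArg n.f1 (hm.comp f g h)).trans (hn.comp _ _ _)
  one₂ f := (congrArg n.f2 (hm.one₂ f)).trans (hn.one₂ _)
  vcomp α β h := (congrArg n.f2 (hm.vcomp α β h)).trans (hn.vcomp _ _ _)
  wl f α h := (congrArg n.f2 (hm.wl f α h)).trans (hn.wl _ _ _)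
  wr α g h := (congrArg n.f2 (hm.wr α g h)).trans (hn.wr _ _ _)

end Ops

end TwoGlob

/-! ### 2-categories and 2-functors in terms of operations on cells -/

namespace TwoCat

open TwoGlob Bicategory

variable {C : TwoCat.{u}}

/-- A 1-cell of a 2-category, with its source and its target. -/
abbrev mk₁ {a b : C} (f : a ⟶ b) : C.glob.C1 := ⟨a, b, f⟩

/-- A 2-cell of a 2-category, with its source and its target. -/
abbrev mk₂ {a b : C} {f g : a ⟶ b} (η : f ⟶ g) : C.glob.C2 := ⟨a, b, f, g, η⟩

/-- Horizontal composition of 1-cells. -/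
def comp₁ : (f g : C.glob.C1) → C.glob.t₁ f = C.glob.s₁ g → C.glob.C1
  | ⟨_, _, f⟩, ⟨_, _, g⟩, rfl => mk₁ (f ≫ g)

/-- Vertical composition of 2-cells. -/
def vcomp₂ : (α β : C.glob.C2) → C.glob.t₂ α = C.glob.s₂ β → C.glob.C2
  | ⟨_, _, _, _, η⟩, ⟨_, _, _, _, θ⟩, rfl => mk₂ (η ≫ θ)

/-- Whiskering on the left. -/
def wl₂ : (f : C.glob.C1) → (α : C.glob.C2) → C.glob.t₁ f = C.glob.s₁ (C.glob.s₂ α) → C.glob.C2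
  | ⟨_, _, f⟩, ⟨_, _, _, _, η⟩, rfl => mk₂ (f ◁ η)

/-- Whiskering on the right. -/
def wr₂ : (α : C.glob.C2) → (f : C.glob.C1) → C.glob.t₁ (C.glob.s₂ α) = C.glob.s₁ f → C.glob.C2
  | ⟨_, _, _, _, η⟩, ⟨_, _, f⟩, rfl => mk₂ (η ▷ f)

variable (C) in
/-- The operations of a 2-category. -/
def ops : C.glob.Ops where
  one a := mk₁ (𝟙 (show C from a))
  comp := comp₁
  one₂ f := mk₂ (𝟙 f.2.2)
  vcomp := vcomp₂
  wl := wl₂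
  wr := wr₂
  s₁_one _ := rfl
  t₁_one _ := rfl
  s₁_comp := by rintro ⟨a, b, f⟩ ⟨_, c, g⟩ ⟨⟩; rfl
  t₁_comp := by rintro ⟨a, b, f⟩ ⟨_, c, g⟩ ⟨⟩; rfl
  s₂_one₂ _ := rfl
  t₂_one₂ _ := rfl
  s₂_vcomp := by rintro ⟨a, b, f, g, η⟩ ⟨_, _, _, h, θ⟩ ⟨⟩; rfl
  t₂_vcomp := by rintro ⟨a, b, f, g, η⟩ ⟨_, _, _, h, θ⟩ ⟨⟩; rfl
  s₂_wl := by rintro ⟨a, b, f⟩ ⟨_, _, _, h, θ⟩ ⟨⟩; rfl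
  t₂_wl := by rintro ⟨a, b, f⟩ ⟨_, _, _, h, θ⟩ ⟨⟩; rfl
  s₂_wr := by rintro ⟨a, b, f, g, η⟩ ⟨_, _, h⟩ ⟨⟩; rfl
  t₂_wr := by rintro ⟨a, b, f, g, η⟩ ⟨_, _, h⟩ ⟨⟩; rfl

theorem mk₂_eqToHom {a b : C} {f f' g g' : a ⟶ b} (hf : f = f') (hg : g' = g) (η : f' ⟶ g') :
    mk₂ (eqToHom hf ≫ η ≫ eqToHom hg) = mk₂ η := by
  subst hf hg
  simp

/-- In a strict bicategory the unitors and associators are of the form `eqToIso`, so conjugation by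
them changes only the type of a 2-cell and is invisible once the cell is bundled with its boundary.
-/
theorem mk₂_conj {a b : C} {f f' g g' : a ⟶ b} {i : f ≅ f'} {j : g ≅ g'} (hf : f = f')
    (hg : g = g') (hi : i = eqToIso hf) (hj : j = eqToIso hg) (η : f' ⟶ g') :
    mk₂ (i.hom ≫ η ≫ j.inv) = mk₂ η := by
  subst hi hj
  exact mk₂_eqToHom hf hg.symm η

theorem mk₂_conj' {a b : C} {f f' g g' : a ⟶ b} {i : f' ≅ f} {j : g' ≅ g} (hf : f' = f)
    (hg : g' = g) (hi : i = eqToIso hf) (hj : j = eqToIso hg) (η : f' ⟶ g') :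
    mk₂ (i.inv ≫ η ≫ j.hom) = mk₂ η := by
  subst hi hj
  exact mk₂_eqToHom hf.symm hg η

theorem mk₁_inj {a b : C} {f g : a ⟶ b} : mk₁ f = mk₁ g ↔ f = g :=
  ⟨fun h => by cases h; rfl, congrArg _⟩

theorem mk₂_inj {a b : C} {f g : a ⟶ b} {η θ : f ⟶ g} :
    mk₂ η = mk₂ θ ↔ η = θ :=
  ⟨fun h => by cases h; rfl, congrArg _⟩

theorem ops_lawful (C : TwoCat.{u}) : C.ops.Lawful where
  one_comp := by
    rintro a ⟨_, b, f⟩ ⟨⟩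
    exact mk₁_inj.2 (Strict.id_comp f)
  comp_one := by
    rintro ⟨_, b, f⟩ a ⟨⟩
    exact mk₁_inj.2 (Strict.comp_id f)
  assoc := by
    rintro ⟨a, b, f⟩ ⟨_, c, g⟩ ⟨_, d, h⟩ ⟨⟩ ⟨⟩
    exact mk₁_inj.2 (Strict.assoc f g h)
  one₂_vcomp := by
    rintro _ ⟨_, b, f, g, η⟩ ⟨⟩
    exact mk₂_inj.2 (Category.id_comp η)
  vcomp_one₂ := by
    rintro ⟨_, b, f, g, η⟩ _ ⟨⟩
    exact mk₂_inj.2 (Category.comp_id η)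
  vassoc := by
    rintro ⟨_, b, f, g, η⟩ ⟨_, _, _, h, θ⟩ ⟨_, _, _, k, κ⟩ ⟨⟩ ⟨⟩
    exact mk₂_inj.2 (Category.assoc η θ κ)
  wl_one₂ := by
    rintro ⟨a, b, f⟩ ⟨_, c, g⟩ ⟨⟩
    exact mk₂_inj.2 (whiskerLeft_id f g)
  wl_vcomp := by
    rintro ⟨a, b, f⟩ ⟨_, c, g, h, η⟩ ⟨_, _, _, k, θ⟩ ⟨⟩ ⟨⟩
    exact mk₂_inj.2 (whiskerLeft_comp f η θ)
  one_wl := by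
    rintro a ⟨_, c, g, h, η⟩ ⟨⟩
    exact (congrArg mk₂ (id_whiskerLeft η)).trans
      (mk₂_conj _ _ (Strict.leftUnitor_eqToIso g) (Strict.leftUnitor_eqToIso h) η)
  comp_wl := by
    rintro ⟨a, b, f⟩ ⟨_, c, g⟩ ⟨_, d, h, k, η⟩ ⟨⟩ ⟨⟩
    exact (congrArg mk₂ (comp_whiskerLeft f g η)).trans
      (mk₂_conj _ _ (Strict.associator_eqToIso f g h) (Strict.associator_eqToIso f g k) _)
  one₂_wr := by
    rintro ⟨a, b, f⟩ ⟨_, c, g⟩ ⟨⟩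
    exact mk₂_inj.2 (id_whiskerRight f g)
  vcomp_wr := by
    rintro ⟨_, b, f, g, η⟩ ⟨_, _, _, h, θ⟩ ⟨_, c, k⟩ ⟨⟩ ⟨⟩
    exact mk₂_inj.2 (comp_whiskerRight η θ k)
  wr_one := by
    rintro ⟨_, b, f, g, η⟩ a ⟨⟩
    exact (congrArg mk₂ (whiskerRight_id η)).trans
      (mk₂_conj _ _ (Strict.rightUnitor_eqToIso f) (Strict.rightUnitor_eqToIso g) η)
  wr_comp := by
    rintro ⟨_, b, f, g, η⟩ ⟨_, c, h⟩ ⟨_, d, k⟩ ⟨⟩ ⟨⟩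
    exact (congrArg mk₂ (whiskerRight_comp η h k)).trans
      (mk₂_conj' _ _ (Strict.associator_eqToIso f h k) (Strict.associator_eqToIso g h k) _)
  wl_wr := by
    rintro ⟨a, b, f⟩ ⟨_, c, g, h, η⟩ ⟨_, d, k⟩ ⟨⟩ ⟨⟩
    exact (congrArg mk₂ (whisker_assoc f η k)).trans
      (mk₂_conj _ _ (Strict.associator_eqToIso f g k) (Strict.associator_eqToIso f h k) _)
  exchange := by
    rintro ⟨a, b, f, g, η⟩ ⟨_, c, h, k, θ⟩ ⟨⟩
    exact mk₂_inj.2 (whisker_exchange η θ)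

variable {D : TwoCat.{u}}

theorem isHom_forget_map (F : C ⟶ D) : C.ops.IsHom D.ops (forget.map F) :=
  let F' : StrictPseudofunctor C D := F
  { one a := mk₁_inj.2 (F'.map_id a)
    comp := by
      rintro ⟨a, b, f⟩ ⟨_, c, g⟩ ⟨⟩
      exact mk₁_inj.2 (F'.map_comp f g)
    one₂ f := mk₂_inj.2 (F'.map₂_id f.2.2)
    vcomp := by
      rintro ⟨a, b, f, g, η⟩ ⟨_, _, _, h, θ⟩ ⟨⟩
      exact mk₂_inj.2 (F'.map₂_comp η θ)
    wl := by
      rintro ⟨a, b, f⟩ ⟨_, c, g, h, η⟩ ⟨⟩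
      exact (congrArg mk₂ (F'.map₂_whisker_left f η)).trans
        (mk₂_conj _ _ (F'.mapComp_eq_eqToIso f g) (F'.mapComp_eq_eqToIso f h) _)
    wr := by
      rintro ⟨_, b, f, g, η⟩ ⟨_, c, h⟩ ⟨⟩
      exact (congrArg mk₂ (F'.map₂_whisker_right η h)).trans
        (mk₂_conj _ _ (F'.mapComp_eq_eqToIso f h) (F'.mapComp_eq_eqToIso g h) _) }

theorem exists_hom {x : D.glob.C1} {a b : D} (ha : D.glob.s₁ x = a) (hb : D.glob.t₁ x = b) :
    ∃ f : a ⟶ b, mk₁ f = x := by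
  subst ha hb
  exact ⟨x.2.2, rfl⟩

theorem exists_cell {x : D.glob.C2} {a b : D} {f g : a ⟶ b} (hf : D.glob.s₂ x = mk₁ f)
    (hg : D.glob.t₂ x = mk₁ g) : ∃ η : f ⟶ g, mk₂ η = x := by
  obtain ⟨a', b', f', g', η⟩ := x
  cases hf
  cases hg
  exact ⟨η, rfl⟩

/-- The image of an arrow under `m` has the expected endpoints only up to a propositional equality.
Typed representatives are therefore chosen, and each functor law is checked after bundling, where it
is a law of `hm`. -/
theorem exists_functor_of_isHom (m : C.glob ⟶ D.glob) (hm : C.ops.IsHom D.ops m) :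
    ∃ F : C ⟶ D, forget.map F = m := by
  choose map hmap using fun {a b : C} (f : a ⟶ b) =>
    exists_hom (m.s₁_f1 (mk₁ f)) (m.t₁_f1 (mk₁ f))
  choose map₂ hmap₂ using fun {a b : C} {f g : a ⟶ b} (η : f ⟶ g) =>
    exists_cell ((m.s₂_f2 (mk₂ η)).trans (hmap f).symm) ((m.t₂_f2 (mk₂ η)).trans (hmap g).symm)
  have map_id (a : C) : map (𝟙 a) = 𝟙 (show D from m.f0 a) :=
    mk₁_inj.1 ((hmap _).trans (hm.one a))
  have map_comp {a b c : C} (f : a ⟶ b) (g : b ⟶ c) : map (f ≫ g) = map f ≫ map g := by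
    refine mk₁_inj.1 ((hmap _).trans ((hm.comp (mk₁ f) (mk₁ g) rfl).trans ?_))
    simp only [← hmap]
    rfl
  refine ⟨StrictPseudofunctor.mk''
    { obj := m.f0
      map := map
      map₂ := map₂
      map_id := map_id
      map_comp := map_comp
      map₂_id := fun {a b} f => ?_
      map₂_comp := fun {a b f g h} η θ => ?_
      map₂_whisker_left := fun {a b c} f {g h} η => ?_
      map₂_whisker_right := fun {a b c f g} η h => ?_ }, hom_ext ?_ ?_ ?_⟩
  · exact mk₂_inj.1 ((hmap₂ _).trans ((hm.one₂ (mk₁ f)).trans (by rw [← hmap]; rfl)))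
  · refine mk₂_inj.1 ((hmap₂ _).trans ((hm.vcomp (mk₂ η) (mk₂ θ) rfl).trans ?_))
    simp only [← hmap₂]
    rfl
  · refine mk₂_inj.1 ((hmap₂ _).trans ((hm.wl (mk₁ f) (mk₂ η) rfl).trans ?_))
    simp only [← hmap, ← hmap₂]
    exact (mk₂_eqToHom _ _ _).symm
  · refine mk₂_inj.1 ((hmap₂ _).trans ((hm.wr (mk₂ η) (mk₁ h) rfl).trans ?_))
    simp only [← hmap, ← hmap₂]
    exact (mk₂_eqToHom _ _ _).symm
  · exact fun _ => rfl
  · exact fun f => hmap f.2.2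
  · exact fun α => hmap₂ α.2.2.2.2

instance : forget.{u}.Faithful where
  map_injective {C D F G} h := by
    obtain ⟨⟨⟨⟨⟨⟨F0, F1⟩, F2⟩, _, _⟩, _, _, _, _, _, _, _⟩, _, _⟩, _, _⟩ := F
    obtain ⟨⟨⟨⟨⟨⟨G0, G1⟩, G2⟩, _, _⟩, _, _, _, _, _, _, _⟩, _, _⟩, _, _⟩ := G
    have h0 : F0 = G0 := congrArg Hom.f0 h
    subst h0
    have h1 : @F1 = @G1 := by
      funext a b f
      exact mk₁_inj.1 (congrFun (congrArg Hom.f1 h) (mk₁ f))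
    subst h1
    have h2 : @F2 = @G2 := by
      funext a b f g η
      exact mk₂_inj.1 (congrFun (congrArg Hom.f2 h) (mk₂ η))
    subst h2
    exact strictPseudofunctor_ext rfl

end TwoCat

/-! ### The universal property of the free 2-category -/

namespace TwoGlob

open Quiver (Path)

variable {X G : TwoGlob.{u}}

/-- The composite in `G` of a path of 1-cells. -/
def evalPath (O : G.Ops) (m : Hom X G) {a : X.Vert} : {b : X.Vert} → Path a b →
    {f : G.C1 // G.s₁ f = m.f0 a ∧ G.t₁ f = m.f0 b}
  | _, .nil => ⟨O.one (m.f0 a), O.s₁_one _, O.t₁_one _⟩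
  | _, .cons p e =>
    ⟨O.comp (evalPath O m p).1 (m.f1 e.1)
      ((evalPath O m p).2.2.trans (by rw [m.s₁_f1, e.2.1])),
      (O.s₁_comp _ _ _).trans (evalPath O m p).2.1,
      (O.t₁_comp _ _ _).trans (by rw [m.t₁_f1, e.2.2])⟩

/-- The composite in `G` of a vertical path of 2-cells. -/
def evalChain (O : G.Ops) (m : Hom X G) {a b : X.Vert} {f : a ⟶ b} : {g : a ⟶ b} → Path f g →
    {α : G.C2 // G.s₂ α = m.f1 f.1 ∧ G.t₂ α = m.f1 g.1}
  | _, .nil => ⟨O.one₂ (m.f1 f.1), O.s₂_one₂ _, O.t₂_one₂ _⟩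
  | _, .cons v α =>
    ⟨O.vcomp (evalChain O m v).1 (m.f2 α.1)
      ((evalChain O m v).2.2.trans (by rw [m.s₂_f2, α.2.1])),
      (O.s₂_vcomp _ _ _).trans (evalChain O m v).2.1,
      (O.t₂_vcomp _ _ _).trans (by rw [m.t₂_f2, α.2.2])⟩

theorem composable_evalPath (O : G.Ops) (m : Hom X G) {a b c : X.Vert} (p : Path a b) (e : b ⟶ c) :
    G.t₁ (evalPath O m p).1 = G.s₁ (m.f1 e.1) :=
  (evalPath O m p).2.2.trans (by rw [m.s₁_f1, e.2.1])

/-- The composite in `G` of a pasting diagram. -/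
def evalCell (O : G.Ops) (m : Hom X G) {a : X.Vert} : {b : X.Vert} → {p q : Path a b} →
    Cell p q → {α : G.C2 // G.s₂ α = (evalPath O m p).1 ∧ G.t₂ α = (evalPath O m q).1}
  | _, _, _, .nil => ⟨O.one₂ (O.one (m.f0 a)), O.s₂_one₂ _, O.t₂_one₂ _⟩
  | _, _, _, .cons (p := p) (q := q) (f := f) (g := g) η v =>
    ⟨O.vcomp
      (O.wr (evalCell O m η).1 (m.f1 f.1)
        (by rw [(evalCell O m η).2.1]; exact composable_evalPath O m p f))
      (O.wl (evalPath O m q).1 (evalChain O m v).1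
        (by rw [(evalChain O m v).2.1]; exact composable_evalPath O m q f))
      (by simp only [O.t₂_wr, O.s₂_wl, (evalCell O m η).2.2, (evalChain O m v).2.1]),
      by simp only [O.s₂_vcomp, O.s₂_wr, (evalCell O m η).2.1]; rfl,
      by simp only [O.t₂_vcomp, O.t₂_wl, (evalChain O m v).2.2]; rfl⟩

/-- The extension of a morphism of 2-globular sets to the free 2-category on its source. -/
def extend (O : G.Ops) (m : X ⟶ G) : (freeObj X).glob ⟶ G :=
  show Hom _ _ from
  { f0 := fun a => Hom.f0 m a
    f1 := fun f => (evalPath O m f.2.2).1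
    f2 := fun α => (evalCell O m α.2.2.2.2).1
    s₁_f1 := fun f => (evalPath O m f.2.2).2.1
    t₁_f1 := fun f => (evalPath O m f.2.2).2.2
    s₂_f2 := fun α => (evalCell O m α.2.2.2.2).2.1
    t₂_f2 := fun α => (evalCell O m α.2.2.2.2).2.2 }

variable {O : G.Ops} (hO : O.Lawful) (m : Hom X G)

theorem inclusion_extend (hO : O.Lawful) (m : X ⟶ G) : X.inclusion ≫ extend O m = m := by
  refine hom_ext (fun a => rfl) (fun e => hO.one_comp _ _ _) (fun α => ?_)
  exact (O.vcomp_congr ((hO.one₂_wr _ _ _).trans (congrArg O.one₂ (hO.one_comp _ _ _)))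
    ((hO.one_wl _ _ _).trans (hO.one₂_vcomp _ _ _)) _).trans (hO.one₂_vcomp _ _ _)

theorem evalPath_comp (hO : O.Lawful) {a b c : X.Vert} (p : Path a b) (q : Path b c) :
    (evalPath O m (p.comp q)).1 = O.comp (evalPath O m p).1 (evalPath O m q).1
      ((evalPath O m p).2.2.trans (evalPath O m q).2.1.symm) := by
  induction q with
  | nil => exact (hO.comp_one _ _ _).symm
  | cons q e ih =>
    exact (O.comp_congr ih rfl _).trans (hO.assoc _ _ _ _ _)

theorem evalChain_comp (hO : O.Lawful) {a b : X.Vert} {f g h : a ⟶ b} (v : Path f g)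
    (w : Path g h) :
    (evalChain O m (v.comp w)).1 = O.vcomp (evalChain O m v).1 (evalChain O m w).1
      ((evalChain O m v).2.2.trans (evalChain O m w).2.1.symm) := by
  induction w with
  | nil => exact (hO.vcomp_one₂ _ _ _).symm
  | cons w e ih =>
    exact (O.vcomp_congr ih rfl _).trans (hO.vassoc _ _ _ _ _)

theorem evalCell_id (hO : O.Lawful) {a b : X.Vert} (p : Path a b) :
    (evalCell O m (Cell.id p)).1 = O.one₂ (evalPath O m p).1 := by
  induction p with
  | nil => rfl
  | cons p e ih =>
    exact (O.vcomp_congr ((O.wr_congr ih rfl _).trans (hO.one₂_wr _ _ _)) (hO.wl_one₂ _ _ _)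
      _).trans (hO.one₂_vcomp _ _ _)

/-- The exchange law in front of a further composite, the form that applies once all vertical
composites are bracketed to the right. -/
theorem Ops.Lawful.exchange_assoc (hO : O.Lawful) (α β κ : G.C2) (h h₁ h₂ h₃ h₄) :
    O.vcomp (O.wl (G.s₂ α) β h) (O.vcomp (O.wr α (G.t₂ β) h₁) κ h₂) h₃ =
      O.vcomp (O.wr α (G.s₂ β) h)
        (O.vcomp (O.wl (G.t₂ α) β ((G.t₁_t₂ α).symm.trans h)) κ h₄) (by simp) :=
  (hO.vassoc _ _ _ (by simp) (by simpa using h₂)).symm.trans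
    ((O.vcomp_congr (hO.exchange α β h) rfl _).trans (hO.vassoc _ _ _ _ _))

/-- After whiskering is distributed over vertical composition, the two sides differ by one exchange
of `θ` and `v`. The boundaries are separate variables because those of evaluated cells are known
only up to propositional equality. -/
theorem Ops.Lawful.interchange (hO : O.Lawful) {η θ v w : G.C2} {f g q r : G.C1}
    (hq : G.s₂ θ = q) (hr : G.t₂ θ = r) (hf : G.s₂ v = f) (hg : G.t₂ v = g)
    (h₁ h₂ h₃ h₄ h₅ h₆ h₇ h₈ h₉ h₁₀ h₁₁ h₁₂) :
    O.vcomp (O.wr (O.vcomp η θ h₁) f h₂) (O.wl r (O.vcomp v w h₃) h₄) h₅ =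
      O.vcomp (O.vcomp (O.wr η f h₆) (O.wl q v h₇) h₈)
        (O.vcomp (O.wr θ g h₉) (O.wl r w h₁₀) h₁₁) h₁₂ := by
  subst hq hr hf hg
  have h : G.t₁ (G.s₂ θ) = G.s₁ (G.s₂ v) := by simpa using h₇
  have h' : G.t₂ (O.wl (G.t₂ θ) v ((G.t₁_t₂ θ).symm.trans h)) =
      G.s₂ (O.wl (G.t₂ θ) w h₁₀) := by simp [h₃]
  simp only [hO.vcomp_wr, hO.wl_vcomp, hO.vassoc, hO.exchange_assoc θ v _ _ _ _ _ h']

theorem evalCell_vcomp (hO : O.Lawful) {a b : X.Vert} {p q r : Path a b} (η : Cell p q)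
    (θ : Cell q r) :
    (evalCell O m (Cell.vcomp η θ)).1 = O.vcomp (evalCell O m η).1 (evalCell O m θ).1
      ((evalCell O m η).2.2.trans (evalCell O m θ).2.1.symm) := by
  induction η with
  | nil => cases θ; exact (hO.one₂_vcomp _ _ _).symm
  | cons η v ih =>
    cases θ with | cons θ w
    exact (O.vcomp_congr (O.wr_congr (ih θ) rfl _)
      (O.wl_congr rfl (evalChain_comp m hO v w) _) _).trans
      (hO.interchange (evalCell O m θ).2.1 (evalCell O m θ).2.2 (evalChain O m v).2.1
        (evalChain O m v).2.2 _ _ _ _ _ _ _ _ _ _ _ _)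

theorem composable_evalCell {a b c : X.Vert} (p : Path a b) {q r : Path b c} (η : Cell q r) :
    G.t₁ (evalPath O m p).1 = G.s₁ (G.s₂ (evalCell O m η).1) := by
  rw [(evalCell O m η).2.1, (evalPath O m p).2.2, (evalPath O m q).2.1]

theorem composable_evalCell' {a b c : X.Vert} {p q : Path a b} (η : Cell p q) (r : Path b c) :
    G.t₁ (G.s₂ (evalCell O m η).1) = G.s₁ (evalPath O m r).1 := by
  rw [(evalCell O m η).2.1, (evalPath O m p).2.2, (evalPath O m r).2.1]

theorem evalCell_whiskerLeft (hO : O.Lawful) {a b c : X.Vert} (p : Path a b) {q r : Path b c}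
    (η : Cell q r) :
    (evalCell O m (Cell.whiskerLeft p η)).1 = O.wl (evalPath O m p).1 (evalCell O m η).1
      (composable_evalCell m p η) := by
  induction η with
  | nil =>
    exact (evalCell_id m hO p).trans
      ((hO.wl_one₂ _ _ _).trans (congrArg O.one₂ (hO.comp_one _ _ _))).symm
  | cons η v ih =>
    exact (O.vcomp_congr ((O.wr_congr ih rfl _).trans (hO.wl_wr _ _ _ _ _))
      ((O.wl_congr (evalPath_comp m hO _ _) rfl _).trans (hO.comp_wl _ _ _ _ _)) _).trans
      (hO.wl_vcomp _ _ _ _ _).symm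

theorem evalCell_whiskerRight (hO : O.Lawful) {a b c : X.Vert} {p q : Path a b} (η : Cell p q)
    (r : Path b c) :
    (evalCell O m (Cell.whiskerRight η r)).1 = O.wr (evalCell O m η).1 (evalPath O m r).1
      (composable_evalCell' m η r) := by
  induction r with
  | nil => exact (hO.wr_one _ _ _).symm
  | cons r e ih =>
    refine (O.vcomp_congr (O.wr_congr ih rfl _) (hO.wl_one₂ _ _ _) _).trans
      ((hO.vcomp_one₂ _ _ _).trans (hO.wr_comp _ _ _ _ _).symm)

theorem isHom_extend (hO : O.Lawful) (m : X ⟶ G) : (freeObj X).ops.IsHom O (extend O m) where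
  one a := rfl
  comp := by
    rintro ⟨a, b, p⟩ ⟨_, c, q⟩ ⟨⟩
    exact evalPath_comp m hO p q
  one₂ p := evalCell_id m hO p.2.2
  vcomp := by
    rintro ⟨a, b, p, q, η⟩ ⟨_, _, _, r, θ⟩ ⟨⟩
    exact evalCell_vcomp m hO η θ
  wl := by
    rintro ⟨a, b, p⟩ ⟨_, c, q, r, η⟩ ⟨⟩
    exact evalCell_whiskerLeft m hO p η
  wr := by
    rintro ⟨a, b, p, q, η⟩ ⟨_, c, r⟩ ⟨⟩
    exact evalCell_whiskerRight m hO η r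

theorem inclusion_f1 {X : TwoGlob.{u}} {a b : X.Vert} (e : a ⟶ b) :
    X.inclusion.f1 e.1 = TwoCat.mk₁ (C := freeObj X) (a := a) (b := b) (e.toPath) := by
  obtain ⟨e, rfl, rfl⟩ := e
  rfl

theorem inclusion_f2 {X : TwoGlob.{u}} {a b : X.Vert} {f g : a ⟶ b} (α : f ⟶ g) :
    X.inclusion.f2 α.1 = TwoCat.mk₂ (C := freeObj X) (a := a) (b := b) (f := f.toPath)
      (g := g.toPath) (Cell.cons Cell.nil α.toPath) := by
  obtain ⟨f, rfl, rfl⟩ := f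
  obtain ⟨g, hg, hg'⟩ := g
  obtain ⟨α, h, h'⟩ := α
  cases h
  cases h'
  rfl

/-- This is what shows that single columns generate all 2-cells under whiskering and vertical
composition. Both whiskerings compute by definition, and only unit laws remain. -/
theorem Cell.cons_eq_vcomp {a b c : X.Vert} {p q : Path a b} {f g : b ⟶ c} (η : Cell p q)
    (v : Path f g) : Cell.cons η v =
      Cell.vcomp (Cell.whiskerRight η f.toPath) (Cell.whiskerLeft q (Cell.cons Cell.nil v)) := by
  change _ = Cell.cons (Cell.vcomp η (Cell.id q)) (Path.nil.comp v)
  rw [Cell.vcomp_id, Path.nil_comp]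

/-- Agreement spreads along the generation of the cells: from 1-cells to paths, from 2-cells to
vertical chains, and from both to pasting diagrams. The axioms of a 2-category play no part in `G`.
-/
theorem hom_free_ext {m n : (freeObj X).glob ⟶ G} (hm : (freeObj X).ops.IsHom O m)
    (hn : (freeObj X).ops.IsHom O n) (h : X.inclusion ≫ m = X.inclusion ≫ n) : m = n := by
  have h0 : m.f0 = n.f0 := (congrArg Hom.f0 h :)
  have e1 {a b : X.Vert} (e : a ⟶ b) : m.f1 ⟨a, b, e.toPath⟩ = n.f1 ⟨a, b, e.toPath⟩ :=
    (congrArg m.f1 (inclusion_f1 e)).symm.trans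
      ((congrFun (congrArg Hom.f1 h :) e.1).trans (congrArg n.f1 (inclusion_f1 e)))
  have h1 {a b : X.Vert} (p : Path a b) : m.f1 ⟨a, b, p⟩ = n.f1 ⟨a, b, p⟩ := by
    induction p with
    | nil => exact (hm.one a).trans ((congrArg O.one (congrFun h0 a)).trans (hn.one a).symm)
    | cons p e ih =>
      exact (hm.comp ⟨_, _, p⟩ ⟨_, _, e.toPath⟩ rfl).trans ((O.comp_congr ih (e1 e) _).trans
        (hn.comp ⟨_, _, p⟩ ⟨_, _, e.toPath⟩ rfl).symm)
  have e2 {a b : X.Vert} {f g : a ⟶ b} (α : f ⟶ g) :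
      m.f2 ⟨a, b, f.toPath, g.toPath, Cell.cons Cell.nil α.toPath⟩ =
        n.f2 ⟨a, b, f.toPath, g.toPath, Cell.cons Cell.nil α.toPath⟩ :=
    (congrArg m.f2 (inclusion_f2 α)).symm.trans
      ((congrFun (congrArg Hom.f2 h :) α.1).trans (congrArg n.f2 (inclusion_f2 α)))
  have hv {a b : X.Vert} {f g : a ⟶ b} (v : Path f g) :
      m.f2 ⟨a, b, f.toPath, g.toPath, Cell.cons Cell.nil v⟩ =
        n.f2 ⟨a, b, f.toPath, g.toPath, Cell.cons Cell.nil v⟩ := by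
    induction v with
    | nil =>
      exact (hm.one₂ ⟨a, b, f.toPath⟩).trans ((congrArg O.one₂ (e1 f)).trans
        (hn.one₂ ⟨a, b, f.toPath⟩).symm)
    | cons v α ih =>
      exact (hm.vcomp ⟨_, _, _, _, Cell.cons Cell.nil v⟩
        ⟨_, _, _, _, Cell.cons Cell.nil α.toPath⟩ rfl).trans ((O.vcomp_congr ih (e2 α) _).trans
        (hn.vcomp ⟨_, _, _, _, Cell.cons Cell.nil v⟩
          ⟨_, _, _, _, Cell.cons Cell.nil α.toPath⟩ rfl).symm)
  have h2 {a b : X.Vert} {p q : Path a b} (η : Cell p q) :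
      m.f2 ⟨a, b, p, q, η⟩ = n.f2 ⟨a, b, p, q, η⟩ := by
    induction η with
    | nil =>
      exact (hm.one₂ ⟨a, a, Path.nil⟩).trans ((congrArg O.one₂ (h1 _)).trans
        (hn.one₂ ⟨a, a, Path.nil⟩).symm)
    | @cons b c p q f g η v ih =>
      have h3 : m.f2 ⟨a, c, p.comp f.toPath, q.comp f.toPath, Cell.whiskerRight η f.toPath⟩ =
          n.f2 ⟨a, c, p.comp f.toPath, q.comp f.toPath, Cell.whiskerRight η f.toPath⟩ :=
        (hm.wr ⟨_, _, _, _, η⟩ ⟨_, _, f.toPath⟩ rfl).trans ((O.wr_congr ih (e1 f) _).trans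
          (hn.wr ⟨_, _, _, _, η⟩ ⟨_, _, f.toPath⟩ rfl).symm)
      have h4 : m.f2 ⟨a, c, q.comp f.toPath, q.comp g.toPath,
            Cell.whiskerLeft q (Cell.cons Cell.nil v)⟩ =
          n.f2 ⟨a, c, q.comp f.toPath, q.comp g.toPath,
            Cell.whiskerLeft q (Cell.cons Cell.nil v)⟩ :=
        (hm.wl ⟨_, _, q⟩ ⟨_, _, _, _, Cell.cons Cell.nil v⟩ rfl).trans
          ((O.wl_congr (h1 q) (hv v) _).trans
            (hn.wl ⟨_, _, q⟩ ⟨_, _, _, _, Cell.cons Cell.nil v⟩ rfl).symm)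
      rw [Cell.cons_eq_vcomp η v]
      exact (hm.vcomp ⟨_, _, _, _, Cell.whiskerRight η f.toPath⟩
        ⟨_, _, _, _, Cell.whiskerLeft q (Cell.cons Cell.nil v)⟩ rfl).trans
        ((O.vcomp_congr h3 h4 _).trans (hn.vcomp ⟨_, _, _, _, Cell.whiskerRight η f.toPath⟩
        ⟨_, _, _, _, Cell.whiskerLeft q (Cell.cons Cell.nil v)⟩ rfl).symm)
  exact hom_ext (congrFun h0) (fun p => h1 p.2.2) (fun η => h2 η.2.2.2.2)

open TwoCat in
/-- The universal property of the free 2-category. -/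
theorem existsUnique_lift (X : TwoGlob.{u}) (C : TwoCat.{u}) (m : X ⟶ forget.obj C) :
    ∃! F : free.obj X ⟶ C, X.inclusion ≫ forget.map F = m := by
  obtain ⟨F, hF⟩ : ∃ F : free.obj X ⟶ C, forget.map F = extend C.ops m :=
    exists_functor_of_isHom _ (isHom_extend C.ops_lawful m)
  refine ⟨F, ?_, fun F' hF' => forget.map_injective ?_⟩
  · dsimp only
    rw [hF]
    exact inclusion_extend C.ops_lawful m
  · refine hom_free_ext (isHom_forget_map F') (isHom_forget_map F) (hF'.trans ?_)
    rw [hF]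
    exact (inclusion_extend C.ops_lawful m).symm

/-- The 2-functor on a free 2-category that extends a given morphism of 2-globular sets. -/
noncomputable def lift {X : TwoGlob.{u}} {C : TwoCat.{u}} (m : X ⟶ TwoCat.forget.obj C) :
    free.obj X ⟶ C :=
  (existsUnique_lift X C m).choose

@[simp]
theorem inclusion_lift {X : TwoGlob.{u}} {C : TwoCat.{u}} (m : X ⟶ TwoCat.forget.obj C) :
    X.inclusion ≫ TwoCat.forget.map (lift m) = m :=
  (existsUnique_lift X C m).choose_spec.1

@[simp]
theorem inclusion_lift_assoc {X Y : TwoGlob.{u}} {C : TwoCat.{u}} (m : X ⟶ TwoCat.forget.obj C)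
    (n : TwoCat.forget.obj C ⟶ Y) : X.inclusion ≫ TwoCat.forget.map (lift m) ≫ n = m ≫ n := by
  rw [← Category.assoc, inclusion_lift]

theorem free_hom_ext {X : TwoGlob.{u}} {C : TwoCat.{u}} {F F' : free.obj X ⟶ C}
    (h : X.inclusion ≫ TwoCat.forget.map F = X.inclusion ≫ TwoCat.forget.map F') : F = F' :=
  (existsUnique_lift X C _).unique h rfl

theorem inclusion_naturality {X Y : TwoGlob.{u}} (m : X ⟶ Y) :
    X.inclusion ≫ TwoCat.forget.map (free.map m) = m ≫ Y.inclusion := by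
  refine hom_ext (fun a => rfl) (fun e => ?_) (fun α => ?_)
  · exact (inclusion_f1 (m.edgeMap.map (edge e rfl rfl))).symm
  · exact (inclusion_f2 ((m.faceMap _ _).map (face (f := edge (X.s₂ α) rfl rfl)
      (g := edge (X.t₂ α) (X.s₁_s₂ α).symm (X.t₁_t₂ α).symm) α rfl rfl))).symm

theorem inclusion_naturality_assoc {X Y Z : TwoGlob.{u}} (m : X ⟶ Y)
    (n : TwoCat.forget.obj (free.obj Y) ⟶ Z) :
    X.inclusion ≫ TwoCat.forget.map (free.map m) ≫ n = m ≫ Y.inclusion ≫ n := by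
  rw [← Category.assoc, inclusion_naturality, Category.assoc]

theorem exists_adjunction :
    ∃ adj : free.{u} ⊣ TwoCat.forget.{u}, ∀ X : TwoGlob.{u}, adj.unit.app X = X.inclusion := by
  refine ⟨Adjunction.mkOfHomEquiv
    { homEquiv X C :=
        { toFun F := X.inclusion ≫ TwoCat.forget.map F
          invFun := lift
          left_inv F := free_hom_ext (inclusion_lift _)
          right_inv m := inclusion_lift m }
      homEquiv_naturality_left_symm f g := free_hom_ext ?_
      homEquiv_naturality_right f g := ?_ }, fun X => ?_⟩
  · simp [inclusion_naturality_assoc]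
  · simp
  · simp

end TwoGlob

/-! ### The 2-category with given lawful operations -/

namespace TwoGlob

namespace Ops

variable {G : TwoGlob.{u}} {O : G.Ops}

/-- The objects of the 2-category with given operations. -/
def Lawful.Obj (_ : O.Lawful) : Type u := G.C0

variable {hO : O.Lawful}

instance : CategoryStruct.{u} hO.Obj where
  Hom a b := { e : G.C1 // G.s₁ e = a ∧ G.t₁ e = b }
  id a := ⟨O.one a, O.s₁_one a, O.t₁_one a⟩
  comp f g := ⟨O.comp f.1 g.1 (f.2.2.trans g.2.1.symm), (O.s₁_comp _ _ _).trans f.2.1,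
    (O.t₁_comp _ _ _).trans g.2.2⟩

instance (a b : hO.Obj) : Category.{u} (a ⟶ b) where
  Hom f g := { α : G.C2 // G.s₂ α = f.1 ∧ G.t₂ α = g.1 }
  id f := ⟨O.one₂ f.1, O.s₂_one₂ _, O.t₂_one₂ _⟩
  comp α β := ⟨O.vcomp α.1 β.1 (α.2.2.trans β.2.1.symm), (O.s₂_vcomp _ _ _).trans α.2.1,
    (O.t₂_vcomp _ _ _).trans β.2.2⟩
  id_comp _ := Subtype.ext (hO.one₂_vcomp _ _ _)
  comp_id _ := Subtype.ext (hO.vcomp_one₂ _ _ _)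
  assoc _ _ _ := Subtype.ext (hO.vassoc _ _ _ _ _)

theorem Lawful.hom_ext {a b : hO.Obj} {f g : a ⟶ b} (h : f.1 = g.1) : f = g := Subtype.ext h

theorem Lawful.cell_ext {a b : hO.Obj} {f g : a ⟶ b} {α β : f ⟶ g} (h : α.1 = β.1) : α = β :=
  Subtype.ext h

theorem Lawful.eqToHom_comp_val {a b : hO.Obj} {f f' g g' : a ⟶ b} (hf : f = f') (hg : g' = g)
    (α : f' ⟶ g') : (eqToHom hf ≫ α ≫ eqToHom hg).1 = α.1 := by
  subst hf hg
  simp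

/-- Whiskering on the left, in terms of the given operations. -/
def Lawful.whiskerLeft {a b c : hO.Obj} (f : a ⟶ b) {g h : b ⟶ c} (η : g ⟶ h) : f ≫ g ⟶ f ≫ h :=
  ⟨O.wl f.1 η.1 (by rw [η.2.1, f.2.2, g.2.1]),
    (O.s₂_wl _ _ _).trans (O.comp_congr rfl η.2.1 _),
    (O.t₂_wl _ _ _).trans (O.comp_congr rfl η.2.2 _)⟩

/-- Whiskering on the right, in terms of the given operations. -/
def Lawful.whiskerRight {a b c : hO.Obj} {f g : a ⟶ b} (η : f ⟶ g) (h : b ⟶ c) : f ≫ h ⟶ g ≫ h :=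
  ⟨O.wr η.1 h.1 (by rw [η.2.1, f.2.2, h.2.1]),
    (O.s₂_wr _ _ _).trans (O.comp_congr η.2.1 rfl _),
    (O.t₂_wr _ _ _).trans (O.comp_congr η.2.2 rfl _)⟩

theorem Lawful.id_comp {a b : hO.Obj} (f : a ⟶ b) : 𝟙 a ≫ f = f :=
  hom_ext (hO.one_comp _ _ _)

theorem Lawful.comp_id {a b : hO.Obj} (f : a ⟶ b) : f ≫ 𝟙 b = f :=
  hom_ext (hO.comp_one _ _ _)

theorem Lawful.comp_assoc {a b c d : hO.Obj} (f : a ⟶ b) (g : b ⟶ c) (h : c ⟶ d) :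
    (f ≫ g) ≫ h = f ≫ g ≫ h :=
  hom_ext (hO.assoc _ _ _ _ _)

theorem Lawful.whiskerLeft_eqToHom {a b c : hO.Obj} (f : a ⟶ b) {g h : b ⟶ c} (e : g = h) :
    whiskerLeft f (eqToHom e) = eqToHom (congrArg (fun g => f ≫ g) e) := by
  subst e
  exact cell_ext (hO.wl_one₂ _ _ _)

theorem Lawful.eqToHom_whiskerRight {a b c : hO.Obj} {f g : a ⟶ b} (e : f = g) (h : b ⟶ c) :
    whiskerRight (eqToHom e) h = eqToHom (congrArg (fun f => f ≫ h) e) := by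
  subst e
  exact cell_ext (hO.one₂_wr _ _ _)

instance : Bicategory.{u, u} hO.Obj where
  whiskerLeft f _ _ η := Lawful.whiskerLeft f η
  whiskerRight η h := Lawful.whiskerRight η h
  associator f g h := eqToIso (Lawful.comp_assoc f g h)
  leftUnitor f := eqToIso (Lawful.id_comp f)
  rightUnitor f := eqToIso (Lawful.comp_id f)
  whiskerLeft_id _ _ := Lawful.cell_ext (hO.wl_one₂ _ _ _)
  whiskerLeft_comp _ _ _ _ _ _ := Lawful.cell_ext (hO.wl_vcomp _ _ _ _ _)
  id_whiskerLeft η :=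
    Lawful.cell_ext ((hO.one_wl _ _ _).trans
      (Lawful.eqToHom_comp_val (Lawful.id_comp _) (Lawful.id_comp _).symm η).symm)
  comp_whiskerLeft f g _ _ η :=
    Lawful.cell_ext ((hO.comp_wl _ _ _ _ _).trans
      (Lawful.eqToHom_comp_val (Lawful.comp_assoc _ _ _) (Lawful.comp_assoc _ _ _).symm
        (Lawful.whiskerLeft f (Lawful.whiskerLeft g η))).symm)
  id_whiskerRight _ _ := Lawful.cell_ext (hO.one₂_wr _ _ _)
  comp_whiskerRight _ _ _ := Lawful.cell_ext (hO.vcomp_wr _ _ _ _ _)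
  whiskerRight_id η :=
    Lawful.cell_ext ((hO.wr_one _ _ _).trans
      (Lawful.eqToHom_comp_val (Lawful.comp_id _) (Lawful.comp_id _).symm η).symm)
  whiskerRight_comp η g h :=
    Lawful.cell_ext ((hO.wr_comp _ _ _ _ _).trans
      (Lawful.eqToHom_comp_val (Lawful.comp_assoc _ _ _).symm (Lawful.comp_assoc _ _ _)
        (Lawful.whiskerRight (Lawful.whiskerRight η g) h)).symm)
  whisker_assoc f _ _ η h :=
    Lawful.cell_ext ((hO.wl_wr _ _ _ _ _).trans
      (Lawful.eqToHom_comp_val (Lawful.comp_assoc _ _ _) (Lawful.comp_assoc _ _ _).symm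
        (Lawful.whiskerLeft f (Lawful.whiskerRight η h))).symm)
  whisker_exchange {a b c f g h i} η θ := by
    -- The exchange axiom whiskers with the boundaries `G.s₂` and `G.t₂` of the two cells, so the
    -- four arrows are replaced by these boundaries.
    obtain ⟨f, hf⟩ := f
    obtain ⟨g, hg⟩ := g
    obtain ⟨h, hh⟩ := h
    obtain ⟨i, hi⟩ := i
    obtain ⟨η, hη, hη'⟩ := η
    obtain ⟨θ, hθ, hθ'⟩ := θ
    dsimp only at hη hη' hθ hθ'
    subst hη hη' hθ hθ'
    exact Lawful.cell_ext (hO.exchange η θ (hf.2.trans hh.1.symm))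
  pentagon _ _ _ _ := by
    simp only [eqToIso.hom, Lawful.whiskerLeft_eqToHom, Lawful.eqToHom_whiskerRight, eqToHom_trans]
  triangle _ _ := by
    simp only [eqToIso.hom, Lawful.whiskerLeft_eqToHom, Lawful.eqToHom_whiskerRight, eqToHom_trans]

instance : Bicategory.Strict hO.Obj where
  id_comp := Lawful.id_comp
  comp_id := Lawful.comp_id
  assoc := Lawful.comp_assoc
  leftUnitor_eqToIso _ := rfl
  rightUnitor_eqToIso _ := rfl
  associator_eqToIso _ _ _ := rfl

/-- The 2-category with given operations on cells. -/
def Lawful.toTwoCat (hO : O.Lawful) : TwoCat.{u} := ⟨hO.Obj⟩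

open TwoCat in
/-- The 2-globular set that underlies the 2-category with given operations on cells. -/
def Lawful.globIso (hO : O.Lawful) : forget.obj hO.toTwoCat ≅ G where
  hom := show Hom (glob hO.toTwoCat) G from
    { f0 := fun a => a
      f1 := fun f => f.2.2.1
      f2 := fun α => α.2.2.2.2.1
      s₁_f1 := fun f => f.2.2.2.1
      t₁_f1 := fun f => f.2.2.2.2
      s₂_f2 := fun α => α.2.2.2.2.2.1
      t₂_f2 := fun α => α.2.2.2.2.2.2 }
  inv := show Hom G (glob hO.toTwoCat) from
    { f0 := fun a => a
      f1 := fun f => ⟨G.s₁ f, G.t₁ f, f, rfl, rfl⟩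
      f2 := fun α => ⟨G.s₁ (G.s₂ α), G.t₁ (G.s₂ α), ⟨G.s₂ α, rfl, rfl⟩,
        ⟨G.t₂ α, (G.s₁_s₂ α).symm, (G.t₁_t₂ α).symm⟩, α, rfl, rfl⟩
      s₁_f1 := fun _ => rfl
      t₁_f1 := fun _ => rfl
      s₂_f2 := fun _ => rfl
      t₂_f2 := fun α => by
        have h {a b} (e : G.C1) (ha : G.s₁ e = a) (hb : G.t₁ e = b) :
            (⟨a, b, e, ha, hb⟩ : (glob hO.toTwoCat).C1) = ⟨G.s₁ e, G.t₁ e, e, rfl, rfl⟩ := by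
          subst ha hb
          rfl
        exact h (G.t₂ α) (G.s₁_s₂ α).symm (G.t₁_t₂ α).symm }
  hom_inv_id := by
    refine TwoGlob.hom_ext (fun a => rfl) ?_ ?_
    · rintro ⟨a, b, f, rfl, rfl⟩
      rfl
    · rintro ⟨a, b, ⟨f, hf, hf'⟩, ⟨g, hg⟩, α, hα, hα'⟩
      dsimp only at hα hα'
      subst hα hα' hf hf'
      rfl
  inv_hom_id := rfl

theorem Lawful.isHom_globIso_hom (hO : O.Lawful) : hO.toTwoCat.ops.IsHom O hO.globIso.hom where
  one _ := rfl
  comp := by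
    rintro ⟨a, b, f⟩ ⟨_, c, g⟩ ⟨⟩
    rfl
  one₂ _ := rfl
  vcomp := by
    rintro ⟨a, b, f, g, η⟩ ⟨_, _, _, h, θ⟩ ⟨⟩
    rfl
  wl := by
    rintro ⟨a, b, f⟩ ⟨_, c, g, h, η⟩ ⟨⟩
    rfl
  wr := by
    rintro ⟨_, b, f, g, η⟩ ⟨_, c, h⟩ ⟨⟩
    rfl

theorem IsHom.inv {H : TwoGlob.{u}} {O' : H.Ops} (i : G ≅ H) (hi : O.IsHom O' i.hom) :
    O'.IsHom O i.inv := by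
  have e0 (a) : i.hom.f0 (i.inv.f0 a) = a := congrFun (congrArg Hom.f0 i.inv_hom_id :) a
  have e1 (a) : i.hom.f1 (i.inv.f1 a) = a := congrFun (congrArg Hom.f1 i.inv_hom_id :) a
  have e2 (a) : i.hom.f2 (i.inv.f2 a) = a := congrFun (congrArg Hom.f2 i.inv_hom_id :) a
  have e1' (a) : i.inv.f1 (i.hom.f1 a) = a := congrFun (congrArg Hom.f1 i.hom_inv_id :) a
  have e2' (a) : i.inv.f2 (i.hom.f2 a) = a := congrFun (congrArg Hom.f2 i.hom_inv_id :) a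
  have i1 : Function.Injective i.hom.f1 := Function.LeftInverse.injective e1'
  have i2 : Function.Injective i.hom.f2 := Function.LeftInverse.injective e2'
  exact
    { one a := i1 (by rw [e1, hi.one, e0])
      comp f g h := i1 (by simp only [e1, hi.comp])
      one₂ f := i2 (by rw [e2, hi.one₂, e1])
      vcomp α β h := i2 (by simp only [e2, hi.vcomp])
      wl f α h := i2 (by simp only [e1, e2, hi.wl])
      wr α f h := i2 (by simp only [e1, e2, hi.wr]) }

end Ops

end TwoGlob

/-! ### Morphisms out of pasting diagrams -/

/-- The 2-pasting diagram with given columns. -/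
def PastingDiagram.ofColumns (l : List (List Unit)) : PastingDiagram 2 := l

namespace TwoGlob

variable {G : TwoGlob.{u}}

/-- A vertical chain of `n` 2-cells from `a` to `b`. -/
structure Column (G : TwoGlob.{u}) (a b : G.C0) (n : ℕ) where
  e : Fin (n + 1) → G.C1
  c : Fin n → G.C2
  s₁_e (j) : G.s₁ (e j) = a
  t₁_e (j) : G.t₁ (e j) = b
  s₂_c (j) : G.s₂ (c j) = e j.castSucc
  t₂_c (j) : G.t₂ (c j) = e j.succ

namespace Column

/-- A 1-cell, as a column. -/
def single (f : G.C1) {a b : G.C0} (ha : G.s₁ f = a) (hb : G.t₁ f = b) : G.Column a b 0 where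
  e _ := f
  c j := j.elim0
  s₁_e _ := ha
  t₁_e _ := hb
  s₂_c j := j.elim0
  t₂_c j := j.elim0

/-- A column with one more 2-cell on top. -/
def cons {a b : G.C0} {n : ℕ} (α : G.C2) (A : G.Column a b n) (h : G.t₂ α = A.e 0) :
    G.Column a b (n + 1) where
  e := Fin.cons (G.s₂ α) A.e
  c := Fin.cons α A.c
  s₁_e := Fin.cases ((G.s₁_s₂ α).trans (by rw [h, A.s₁_e])) A.s₁_e
  t₁_e := Fin.cases ((G.t₁_t₂ α).trans (by rw [h, A.t₁_e])) A.t₁_e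
  s₂_c := Fin.cases rfl (fun j => by simp [A.s₂_c])
  t₂_c := Fin.cases h (fun j => by simp [A.t₂_c])

/-- A 2-cell, as a column. -/
def single₂ (α : G.C2) {a b : G.C0} (ha : G.s₁ (G.s₂ α) = a) (hb : G.t₁ (G.s₂ α) = b) :
    G.Column a b 1 :=
  cons α (single (G.t₂ α) ((G.s₁_s₂ α).symm.trans ha) ((G.t₁_t₂ α).symm.trans hb)) rfl

/-- The morphism from a pasting diagram that is given by a sequence of columns. -/
def glue (P : PastingDiagram 2) (v : Fin (P.width + 1) → G.C0)
    (A : ∀ i : Fin P.width, G.Column (v i.castSucc) (v i.succ) (P.height i)) : P.toGlob ⟶ G :=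
  show Hom _ _ from
  { f0 := fun i => v i.down
    f1 := fun e => (A e.down.1).e e.down.2
    f2 := fun α => (A α.down.1).c α.down.2
    s₁_f1 := fun e => (A e.down.1).s₁_e _
    t₁_f1 := fun e => (A e.down.1).t₁_e _
    s₂_f2 := fun α => (A α.down.1).s₂_c _
    t₂_f2 := fun α => (A α.down.1).t₂_c _ }

open PastingDiagram

variable {a b c d : G.C0} (k l m : List Unit)

/-- The morphism given by one column. -/
def glue₁ (A : G.Column a b k.length) : (ofColumns [k]).toGlob ⟶ G :=
  glue _ ![a, b] (Fin.cons (n := 0) A fun i => i.elim0)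

/-- The morphism given by two columns. -/
def glue₂ (A : G.Column a b k.length) (B : G.Column b c l.length) :
    (ofColumns [k, l]).toGlob ⟶ G :=
  glue _ ![a, b, c] (Fin.cons (n := 1) A (Fin.cons (n := 0) B fun i => i.elim0))

/-- The morphism given by three columns. -/
def glue₃ (A : G.Column a b k.length) (B : G.Column b c l.length) (C : G.Column c d m.length) :
    (ofColumns [k, l, m]).toGlob ⟶ G :=
  glue _ ![a, b, c, d] (Fin.cons (n := 2) A (Fin.cons (n := 1) B (Fin.cons (n := 0) C fun i => i.elim0)))

end Column

open PastingDiagram Column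

/-- Each later 1-cell of a column is the target of a 2-cell, and each 0-cell bounds a 1-cell. The
latter fails for the diagram of width zero, hence `hP`. -/
theorem toGlob_hom_ext {P : PastingDiagram 2} (hP : 0 < P.width) {χ χ' : P.toGlob ⟶ G}
    (h : ∀ i, χ.f1 ⟨i, 0⟩ = χ'.f1 ⟨i, 0⟩ ∧ ∀ j, χ.f2 ⟨i, j⟩ = χ'.f2 ⟨i, j⟩) : χ = χ' := by
  have h1 (i : Fin P.width) (j : Fin (P.height i + 1)) : χ.f1 ⟨i, j⟩ = χ'.f1 ⟨i, j⟩ := by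
    induction j using Fin.cases with
    | zero => exact (h i).1
    | succ j =>
      exact (χ.t₂_f2 ⟨i, j⟩).symm.trans ((congrArg G.t₂ ((h i).2 j)).trans (χ'.t₂_f2 ⟨i, j⟩))
  refine hom_ext (fun v => ?_) (fun e => h1 _ _) (fun α => (h _).2 _)
  obtain ⟨v⟩ := v
  induction v using Fin.cases with
  | zero =>
    exact (χ.s₁_f1 ⟨⟨0, hP⟩, 0⟩).symm.trans ((congrArg G.s₁ (h1 _ _)).trans
      (χ'.s₁_f1 ⟨⟨0, hP⟩, 0⟩))
  | succ i =>
    exact (χ.t₁_f1 ⟨i, 0⟩).symm.trans ((congrArg G.t₁ (h1 _ _)).trans (χ'.t₁_f1 ⟨i, 0⟩))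

/-- In a nonempty column the first 1-cell is the source of the first 2-cell. -/
theorem toGlob_hom_column {P : PastingDiagram 2} {χ χ' : P.toGlob ⟶ G} {i : Fin P.width}
    (hi : 0 < P.height i) (h : ∀ j, χ.f2 ⟨i, j⟩ = χ'.f2 ⟨i, j⟩) :
    χ.f1 ⟨i, 0⟩ = χ'.f1 ⟨i, 0⟩ ∧ ∀ j, χ.f2 ⟨i, j⟩ = χ'.f2 ⟨i, j⟩ :=
  ⟨(χ.s₂_f2 ⟨i, ⟨0, hi⟩⟩).symm.trans ((congrArg G.s₂ (h _)).trans (χ'.s₂_f2 ⟨i, ⟨0, hi⟩⟩)), h⟩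

/-- The diagram that consists of one 0-cell. -/
abbrev pointDiagram : PastingDiagram 2 := ofColumns []

/-- The diagram that consists of one 1-cell. -/
abbrev edgeDiagram : PastingDiagram 2 := ofColumns [[]]

/-- The diagram that consists of one 2-cell. -/
abbrev faceDiagram : PastingDiagram 2 := ofColumns [[()]]

/-- The only 0-cell of its diagram. -/
abbrev pointCell : pointDiagram.toGlob.{u}.C0 := ⟨(0 : Fin 1)⟩

/-- The only 1-cell of its diagram. -/
abbrev edgeCell : edgeDiagram.toGlob.{u}.C1 := ⟨(0 : Fin 1), (0 : Fin 1)⟩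

/-- The only 2-cell of its diagram. -/
abbrev faceCell : faceDiagram.toGlob.{u}.C2 := ⟨(0 : Fin 1), (0 : Fin 1)⟩

/-- The diagrams with one cell are the globes, so this and the next two lemmas are instances of the
Yoneda lemma. -/
theorem existsUnique_point (a : G.C0) :
    ∃! χ : pointDiagram.toGlob ⟶ G, χ.f0 pointCell = a := by
  refine ⟨Column.glue _ (fun _ => a) (fun i => i.elim0), rfl, fun χ h => hom_ext ?_ ?_ ?_⟩
  · rintro ⟨i⟩
    obtain rfl : i = 0 := Subsingleton.elim (α := Fin 1) _ _
    exact h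
  · rintro ⟨i, j⟩
    exact i.elim0
  · rintro ⟨i, j⟩
    exact i.elim0

theorem existsUnique_edge (f : G.C1) :
    ∃! χ : edgeDiagram.toGlob ⟶ G, χ.f1 edgeCell = f := by
  refine ⟨glue₁ [] (single f rfl rfl), rfl,
    fun χ h => toGlob_hom_ext (P := edgeDiagram) Nat.one_pos ?_⟩
  exact Fin.cases (n := 0) ⟨h, fun j => j.elim0⟩ (fun i => i.elim0)

theorem existsUnique_face (α : G.C2) :
    ∃! χ : faceDiagram.toGlob ⟶ G, χ.f2 faceCell = α := by
  refine ⟨glue₁ [()] (single₂ α rfl rfl), rfl,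
    fun χ h => toGlob_hom_ext (P := faceDiagram) Nat.one_pos ?_⟩
  exact Fin.cases (n := 0) (toGlob_hom_column (P := faceDiagram) Nat.one_pos
    (Fin.cases (n := 0) h (fun i => i.elim0))) (fun i => i.elim0)

/-- From here on the diagrams represent the domains of the binary operations. Uniqueness later
identifies the diagram chosen in the definition of an operation with one that is at hand. -/
theorem existsUnique_comp (f g : G.C1) (h : G.t₁ f = G.s₁ g) :
    ∃! χ : (ofColumns [[], []]).toGlob ⟶ G,
      χ.f1 ⟨(0 : Fin 2), (0 : Fin 1)⟩ = f ∧ χ.f1 ⟨(1 : Fin 2), (0 : Fin 1)⟩ = g := by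
  refine ⟨glue₂ [] [] (single f rfl rfl) (single g h.symm rfl), ⟨rfl, rfl⟩,
    fun χ hχ => toGlob_hom_ext (P := ofColumns [[], []]) Nat.two_pos ?_⟩
  exact Fin.cases (n := 1) ⟨hχ.1, fun j => j.elim0⟩
    (Fin.cases (n := 0) ⟨hχ.2, fun j => j.elim0⟩ (fun i => i.elim0))

theorem existsUnique_vcomp (α β : G.C2) (h : G.t₂ α = G.s₂ β) :
    ∃! χ : (ofColumns [[(), ()]]).toGlob ⟶ G,
      χ.f2 ⟨(0 : Fin 1), (0 : Fin 2)⟩ = α ∧ χ.f2 ⟨(0 : Fin 1), (1 : Fin 2)⟩ = β := by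
  refine ⟨glue₁ [(), ()] (cons α (single₂ β rfl rfl) h), ⟨rfl, rfl⟩,
    fun χ hχ => toGlob_hom_ext (P := ofColumns [[(), ()]]) Nat.one_pos ?_⟩
  exact Fin.cases (n := 0) (toGlob_hom_column (P := ofColumns [[(), ()]]) Nat.two_pos
    (Fin.cases (n := 1) hχ.1 (Fin.cases (n := 0) hχ.2 (fun i => i.elim0)))) (fun i => i.elim0)

theorem existsUnique_wl (f : G.C1) (α : G.C2) (h : G.t₁ f = G.s₁ (G.s₂ α)) :
    ∃! χ : (ofColumns [[], [()]]).toGlob ⟶ G,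
      χ.f1 ⟨(0 : Fin 2), (0 : Fin 1)⟩ = f ∧ χ.f2 ⟨(1 : Fin 2), (0 : Fin 1)⟩ = α := by
  refine ⟨glue₂ [] [()] (single f rfl rfl) (single₂ α h.symm rfl), ⟨rfl, rfl⟩,
    fun χ hχ => toGlob_hom_ext (P := ofColumns [[], [()]]) Nat.two_pos ?_⟩
  exact Fin.cases (n := 1) ⟨hχ.1, fun j => j.elim0⟩
    (Fin.cases (n := 0) (toGlob_hom_column (P := ofColumns [[], [()]]) Nat.one_pos
      (Fin.cases (n := 0) hχ.2 (fun i => i.elim0))) (fun i => i.elim0))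

theorem existsUnique_wr (α : G.C2) (f : G.C1) (h : G.t₁ (G.s₂ α) = G.s₁ f) :
    ∃! χ : (ofColumns [[()], []]).toGlob ⟶ G,
      χ.f2 ⟨(0 : Fin 2), (0 : Fin 1)⟩ = α ∧ χ.f1 ⟨(1 : Fin 2), (0 : Fin 1)⟩ = f := by
  refine ⟨glue₂ [()] [] (single₂ α rfl rfl) (single f h.symm rfl), ⟨rfl, rfl⟩,
    fun χ hχ => toGlob_hom_ext (P := ofColumns [[()], []]) Nat.two_pos ?_⟩
  exact Fin.cases (n := 1) (toGlob_hom_column (P := ofColumns [[()], []]) Nat.one_pos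
      (Fin.cases (n := 0) hχ.1 (fun i => i.elim0)))
    (Fin.cases (n := 0) ⟨hχ.2, fun j => j.elim0⟩ (fun i => i.elim0))

namespace Hom

variable {X Y : TwoGlob.{u}} (φ : Hom X Y)

theorem t₁_eq_s₁ {e e' : X.C1} (h : X.t₁ e = X.s₁ e') : Y.t₁ (φ.f1 e) = Y.s₁ (φ.f1 e') := by
  rw [φ.t₁_f1, φ.s₁_f1, h]

theorem t₂_eq_s₂ {α β : X.C2} (h : X.t₂ α = X.s₂ β) : Y.t₂ (φ.f2 α) = Y.s₂ (φ.f2 β) := by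
  rw [φ.t₂_f2, φ.s₂_f2, h]

theorem t₁_eq_s₁_s₂ {e : X.C1} {α : X.C2} (h : X.t₁ e = X.s₁ (X.s₂ α)) :
    Y.t₁ (φ.f1 e) = Y.s₁ (Y.s₂ (φ.f2 α)) := by
  rw [φ.t₁_f1, φ.s₂_f2, φ.s₁_f1, h]

theorem t₁_s₂_eq_s₁ {e : X.C1} {α : X.C2} (h : X.t₁ (X.s₂ α) = X.s₁ e) :
    Y.t₁ (Y.s₂ (φ.f2 α)) = Y.s₁ (φ.f1 e) := by
  rw [φ.s₁_f1, φ.s₂_f2, φ.t₁_f1, h]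

end Hom

/-! ### Operations are detected on pasting diagrams -/

section cover

variable {O : G.Ops}

/-- The variables of an axiom form a map from a small diagram, which factors through a lawful `K`.
The axiom holds in `K` for the corresponding cells, and `m` carries it to `G`. -/
theorem Ops.lawful_of_cover (H : ∀ (P : PastingDiagram 2) (χ : P.toGlob ⟶ G),
    ∃ (K : TwoGlob.{u}) (O' : K.Ops) (_ : O'.Lawful) (i : P.toGlob ⟶ K) (m : K ⟶ G),
      O'.IsHom O m ∧ i ≫ m = χ) : O.Lawful where
  one_comp a f h := by
    obtain ⟨χ, rfl, -⟩ := existsUnique_edge f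
    obtain ⟨K, O', hO', i, m, hm, rfl⟩ := H _ χ
    -- Composability forces `a` to be the source of the 1-cell, so the diagram need not record it.
    obtain rfl := (O.t₁_one a).symm.trans (h.trans (Hom.s₁_f1 _ edgeCell))
    have key := congrArg m.f1 (hO'.one_comp _ (i.f1 edgeCell)
      ((O'.t₁_one _).trans (i.s₁_f1 _).symm))
    simp only [hm.comp, hm.one] at key
    exact key
  comp_one f a h := by
    obtain ⟨χ, rfl, -⟩ := existsUnique_edge f
    obtain ⟨K, O', hO', i, m, hm, rfl⟩ := H _ χ
    obtain rfl := (O.s₁_one a).symm.trans (h.symm.trans (Hom.t₁_f1 _ edgeCell))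
    have key := congrArg m.f1 (hO'.comp_one (i.f1 edgeCell) _
      ((i.t₁_f1 _).trans (O'.s₁_one _).symm))
    simp only [hm.comp, hm.one] at key
    exact key
  assoc f g h h₁ h₂ := by
    obtain ⟨χ, rfl, rfl, rfl⟩ : ∃ χ : (ofColumns [[], [], []]).toGlob ⟶ G,
        χ.f1 ⟨(0 : Fin 3), (0 : Fin 1)⟩ = f ∧ χ.f1 ⟨(1 : Fin 3), (0 : Fin 1)⟩ = g ∧
          χ.f1 ⟨(2 : Fin 3), (0 : Fin 1)⟩ = h :=
      ⟨glue₃ [] [] [] (single f rfl rfl) (single g h₁.symm rfl)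
        (single h (h₂.symm.trans (O.t₁_comp _ _ _)) rfl), rfl, rfl, rfl⟩
    obtain ⟨K, O', hO', i, m, hm, rfl⟩ := H _ χ
    have key := congrArg m.f1 (hO'.assoc
      (i.f1 ⟨(0 : Fin 3), (0 : Fin 1)⟩) (i.f1 ⟨(1 : Fin 3), (0 : Fin 1)⟩)
      (i.f1 ⟨(2 : Fin 3), (0 : Fin 1)⟩)
      (i.t₁_eq_s₁ rfl)
      ((O'.t₁_comp _ _ _).trans (i.t₁_eq_s₁ rfl)))
    simp only [hm.comp] at key
    exact key
  one₂_vcomp f α h := by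
    obtain ⟨χ, rfl, -⟩ := existsUnique_face α
    obtain ⟨K, O', hO', i, m, hm, rfl⟩ := H _ χ
    obtain rfl := (O.t₂_one₂ f).symm.trans (h.trans (Hom.s₂_f2 _ faceCell))
    have key := congrArg m.f2
      (hO'.one₂_vcomp _ (i.f2 faceCell)
      ((O'.t₂_one₂ _).trans (i.s₂_f2 _).symm))
    simp only [hm.vcomp, hm.one₂] at key
    exact key
  vcomp_one₂ α f h := by
    obtain ⟨χ, rfl, -⟩ := existsUnique_face α
    obtain ⟨K, O', hO', i, m, hm, rfl⟩ := H _ χ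
    obtain rfl := (O.s₂_one₂ f).symm.trans (h.symm.trans (Hom.t₂_f2 _ faceCell))
    have key := congrArg m.f2
      (hO'.vcomp_one₂ (i.f2 faceCell) _
      ((i.t₂_f2 _).trans (O'.s₂_one₂ _).symm))
    simp only [hm.vcomp, hm.one₂] at key
    exact key
  vassoc α β γ h₁ h₂ := by
    obtain ⟨χ, rfl, rfl, rfl⟩ : ∃ χ : (ofColumns [[(), (), ()]]).toGlob ⟶ G,
        χ.f2 ⟨(0 : Fin 1), (0 : Fin 3)⟩ = α ∧ χ.f2 ⟨(0 : Fin 1), (1 : Fin 3)⟩ = β ∧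
          χ.f2 ⟨(0 : Fin 1), (2 : Fin 3)⟩ = γ :=
      ⟨glue₁ [(), (), ()] (cons α (cons β (single₂ γ rfl rfl)
        ((O.t₂_vcomp _ _ _).symm.trans h₂)) h₁), rfl, rfl, rfl⟩
    obtain ⟨K, O', hO', i, m, hm, rfl⟩ := H _ χ
    have key := congrArg m.f2 (hO'.vassoc
      (i.f2 ⟨(0 : Fin 1), (0 : Fin 3)⟩) (i.f2 ⟨(0 : Fin 1), (1 : Fin 3)⟩)
      (i.f2 ⟨(0 : Fin 1), (2 : Fin 3)⟩)
      (i.t₂_eq_s₂ rfl)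
      ((O'.t₂_vcomp _ _ _).trans (i.t₂_eq_s₂ rfl)))
    simp only [hm.vcomp] at key
    exact key
  wl_one₂ f g h := by
    obtain ⟨χ, ⟨rfl, rfl⟩, -⟩ := existsUnique_comp f g
      (h.trans (congrArg G.s₁ (O.s₂_one₂ g)))
    obtain ⟨K, O', hO', i, m, hm, rfl⟩ := H _ χ
    have key := congrArg m.f2 (hO'.wl_one₂
      (i.f1 ⟨(0 : Fin 2), (0 : Fin 1)⟩) (i.f1 ⟨(1 : Fin 2), (0 : Fin 1)⟩)
      ((i.t₁_eq_s₁ rfl).trans (congrArg K.s₁ (O'.s₂_one₂ _).symm)))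
    simp only [hm.wl, hm.one₂, hm.comp] at key
    exact key
  wl_vcomp f α β h₁ h₂ := by
    obtain ⟨χ, rfl, rfl, rfl⟩ : ∃ χ : (ofColumns [[], [(), ()]]).toGlob ⟶ G,
        χ.f1 ⟨(0 : Fin 2), (0 : Fin 1)⟩ = f ∧ χ.f2 ⟨(1 : Fin 2), (0 : Fin 2)⟩ = α ∧
          χ.f2 ⟨(1 : Fin 2), (1 : Fin 2)⟩ = β :=
      ⟨glue₂ [] [(), ()] (single f rfl
        ((h₂.trans (congrArg G.s₁ ((O.s₂_vcomp _ _ _).trans rfl))).trans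
          ((G.s₁_s₂ α).trans (congrArg G.s₁ h₁))))
        (cons α (single₂ β rfl rfl) h₁), rfl, rfl, rfl⟩
    obtain ⟨K, O', hO', i, m, hm, rfl⟩ := H _ χ
    have key := congrArg m.f2 (hO'.wl_vcomp
      (i.f1 ⟨(0 : Fin 2), (0 : Fin 1)⟩) (i.f2 ⟨(1 : Fin 2), (0 : Fin 2)⟩)
      (i.f2 ⟨(1 : Fin 2), (1 : Fin 2)⟩)
      (i.t₂_eq_s₂ rfl)
      ((i.t₁_eq_s₁_s₂ rfl).trans (congrArg K.s₁ (O'.s₂_vcomp _ _ _).symm)))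
    simp only [hm.wl, hm.vcomp] at key
    exact key
  one_wl a α h := by
    obtain ⟨χ, rfl, -⟩ := existsUnique_face α
    obtain ⟨K, O', hO', i, m, hm, rfl⟩ := H _ χ
    obtain rfl := (O.t₁_one a).symm.trans (h.trans
      ((congrArg G.s₁ (Hom.s₂_f2 _ faceCell)).trans (Hom.s₁_f1 _ _)))
    have key := congrArg m.f2
      (hO'.one_wl _ (i.f2 faceCell)
      ((O'.t₁_one _).trans ((congrArg K.s₁ (i.s₂_f2 _)).trans (i.s₁_f1 _)).symm))
    simp only [hm.wl, hm.one] at key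
    exact key
  comp_wl f g α h₁ h₂ := by
    obtain ⟨χ, rfl, rfl, rfl⟩ : ∃ χ : (ofColumns [[], [], [()]]).toGlob ⟶ G,
        χ.f1 ⟨(0 : Fin 3), (0 : Fin 1)⟩ = f ∧ χ.f1 ⟨(1 : Fin 3), (0 : Fin 1)⟩ = g ∧
          χ.f2 ⟨(2 : Fin 3), (0 : Fin 1)⟩ = α :=
      ⟨glue₃ [] [] [()] (single f rfl rfl) (single g h₁.symm rfl)
        (single₂ α (h₂.symm.trans (O.t₁_comp _ _ _)) rfl), rfl, rfl, rfl⟩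
    obtain ⟨K, O', hO', i, m, hm, rfl⟩ := H _ χ
    have key := congrArg m.f2 (hO'.comp_wl
      (i.f1 ⟨(0 : Fin 3), (0 : Fin 1)⟩) (i.f1 ⟨(1 : Fin 3), (0 : Fin 1)⟩)
      (i.f2 ⟨(2 : Fin 3), (0 : Fin 1)⟩)
      (i.t₁_eq_s₁ rfl)
      ((O'.t₁_comp _ _ _).trans (i.t₁_eq_s₁_s₂ rfl)))
    simp only [hm.comp, hm.wl] at key
    exact key
  one₂_wr f g h := by
    obtain ⟨χ, ⟨rfl, rfl⟩, -⟩ := existsUnique_comp f g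
      ((congrArg G.t₁ (O.s₂_one₂ f)).symm.trans h)
    obtain ⟨K, O', hO', i, m, hm, rfl⟩ := H _ χ
    have key := congrArg m.f2 (hO'.one₂_wr
      (i.f1 ⟨(0 : Fin 2), (0 : Fin 1)⟩) (i.f1 ⟨(1 : Fin 2), (0 : Fin 1)⟩)
      ((congrArg K.t₁ (O'.s₂_one₂ _)).trans (i.t₁_eq_s₁ rfl)))
    simp only [hm.wr, hm.one₂, hm.comp] at key
    exact key
  vcomp_wr α β f h₁ h₂ := by
    obtain ⟨χ, rfl, rfl, rfl⟩ : ∃ χ : (ofColumns [[(), ()], []]).toGlob ⟶ G,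
        χ.f2 ⟨(0 : Fin 2), (0 : Fin 2)⟩ = α ∧ χ.f2 ⟨(0 : Fin 2), (1 : Fin 2)⟩ = β ∧
          χ.f1 ⟨(1 : Fin 2), (0 : Fin 1)⟩ = f :=
      ⟨glue₂ [(), ()] [] (cons α (single₂ β rfl rfl) h₁) (single f
        ((h₂.symm.trans (congrArg G.t₁ (O.s₂_vcomp _ _ _))).trans
          ((G.t₁_t₂ α).trans (congrArg G.t₁ h₁))) rfl), rfl, rfl, rfl⟩
    obtain ⟨K, O', hO', i, m, hm, rfl⟩ := H _ χ
    have key := congrArg m.f2 (hO'.vcomp_wr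
      (i.f2 ⟨(0 : Fin 2), (0 : Fin 2)⟩) (i.f2 ⟨(0 : Fin 2), (1 : Fin 2)⟩)
      (i.f1 ⟨(1 : Fin 2), (0 : Fin 1)⟩)
      (i.t₂_eq_s₂ rfl)
      ((congrArg K.t₁ (O'.s₂_vcomp _ _ _)).trans (i.t₁_s₂_eq_s₁ rfl)))
    simp only [hm.wr, hm.vcomp] at key
    exact key
  wr_one α a h := by
    obtain ⟨χ, rfl, -⟩ := existsUnique_face α
    obtain ⟨K, O', hO', i, m, hm, rfl⟩ := H _ χ
    obtain rfl := (O.s₁_one a).symm.trans (h.symm.trans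
      ((congrArg G.t₁ (Hom.s₂_f2 _ faceCell)).trans (Hom.t₁_f1 _ _)))
    have key := congrArg m.f2
      (hO'.wr_one (i.f2 faceCell) _
      (((congrArg K.t₁ (i.s₂_f2 _)).trans (i.t₁_f1 _)).trans (O'.s₁_one _).symm))
    simp only [hm.wr, hm.one] at key
    exact key
  wr_comp α f g h₁ h₂ := by
    obtain ⟨χ, rfl, rfl, rfl⟩ : ∃ χ : (ofColumns [[()], [], []]).toGlob ⟶ G,
        χ.f2 ⟨(0 : Fin 3), (0 : Fin 1)⟩ = α ∧ χ.f1 ⟨(1 : Fin 3), (0 : Fin 1)⟩ = f ∧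
          χ.f1 ⟨(2 : Fin 3), (0 : Fin 1)⟩ = g :=
      ⟨glue₃ [()] [] [] (single₂ α rfl (h₂.trans (O.s₁_comp _ _ _))) (single f rfl rfl)
        (single g h₁.symm rfl), rfl, rfl, rfl⟩
    obtain ⟨K, O', hO', i, m, hm, rfl⟩ := H _ χ
    have key := congrArg m.f2 (hO'.wr_comp
      (i.f2 ⟨(0 : Fin 3), (0 : Fin 1)⟩) (i.f1 ⟨(1 : Fin 3), (0 : Fin 1)⟩)
      (i.f1 ⟨(2 : Fin 3), (0 : Fin 1)⟩)
      (i.t₁_eq_s₁ rfl)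
      ((i.t₁_s₂_eq_s₁ rfl).trans (O'.s₁_comp _ _ _).symm))
    simp only [hm.comp, hm.wr] at key
    exact key
  wl_wr f α g h₁ h₂ := by
    obtain ⟨χ, rfl, rfl, rfl⟩ : ∃ χ : (ofColumns [[], [()], []]).toGlob ⟶ G,
        χ.f1 ⟨(0 : Fin 3), (0 : Fin 1)⟩ = f ∧ χ.f2 ⟨(1 : Fin 3), (0 : Fin 1)⟩ = α ∧
          χ.f1 ⟨(2 : Fin 3), (0 : Fin 1)⟩ = g :=
      ⟨glue₃ [] [()] [] (single f rfl rfl) (single₂ α h₁.symm rfl)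
        (single g (h₂.symm.trans ((congrArg G.t₁ (O.s₂_wl _ _ _)).trans (O.t₁_comp _ _ _))) rfl),
        rfl, rfl, rfl⟩
    obtain ⟨K, O', hO', i, m, hm, rfl⟩ := H _ χ
    have key := congrArg m.f2 (hO'.wl_wr
      (i.f1 ⟨(0 : Fin 3), (0 : Fin 1)⟩) (i.f2 ⟨(1 : Fin 3), (0 : Fin 1)⟩)
      (i.f1 ⟨(2 : Fin 3), (0 : Fin 1)⟩)
      (i.t₁_eq_s₁_s₂ rfl)
      ((congrArg K.t₁ (O'.s₂_wl _ _ _)).trans ((O'.t₁_comp _ _ _).trans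
        (i.t₁_s₂_eq_s₁ rfl))))
    simp only [hm.wl, hm.wr] at key
    exact key
  exchange α β h := by
    obtain ⟨χ, rfl, rfl⟩ : ∃ χ : (ofColumns [[()], [()]]).toGlob ⟶ G,
        χ.f2 ⟨(0 : Fin 2), (0 : Fin 1)⟩ = α ∧ χ.f2 ⟨(1 : Fin 2), (0 : Fin 1)⟩ = β :=
      ⟨glue₂ [()] [()] (single₂ α rfl rfl) (single₂ β h.symm rfl), rfl, rfl⟩
    obtain ⟨K, O', hO', i, m, hm, rfl⟩ := H _ χ
    have key := congrArg m.f2 (hO'.exchange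
      (i.f2 ⟨(0 : Fin 2), (0 : Fin 1)⟩) (i.f2 ⟨(1 : Fin 2), (0 : Fin 1)⟩)
      ((congrArg K.t₁ (i.s₂_f2 _)).trans (i.t₁_eq_s₁_s₂ rfl)))
    -- Here the axiom also mentions boundaries of cells, so `m` has to be moved past `s₂` and `t₂`
    -- as well.
    simp only [hm.vcomp, hm.wl, hm.wr, ← m.s₂_f2, ← m.t₂_f2] at key
    exact key

/-- The arguments of an operation lift to some `K`; comparing what `m` and `m ≫ n` do to the
operation performed in `K` gives the claim for `n`. No axioms are needed. -/
theorem Ops.isHom_of_cover {H : TwoGlob.{u}} {O' : H.Ops} (n : G ⟶ H)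
    (h : ∀ (P : PastingDiagram 2) (χ : P.toGlob ⟶ G), ∃ (K : TwoGlob.{u}) (O'' : K.Ops)
      (i : P.toGlob ⟶ K) (m : K ⟶ G), i ≫ m = χ ∧ O''.IsHom O m ∧ O''.IsHom O' (m ≫ n)) :
    O.IsHom O' n where
  one a := by
    obtain ⟨χ, rfl, -⟩ := existsUnique_point a
    obtain ⟨K, O'', i, m, rfl, hm, hmn⟩ := h _ χ
    exact (congrArg n.f1 (hm.one (i.f0 pointCell))).symm.trans (hmn.one _)
  comp f g e := by
    obtain ⟨χ, ⟨rfl, rfl⟩, -⟩ := existsUnique_comp f g e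
    obtain ⟨K, O'', i, m, rfl, hm, hmn⟩ := h _ χ
    exact (congrArg n.f1 (hm.comp (i.f1 ⟨(0 : Fin 2), (0 : Fin 1)⟩)
      (i.f1 ⟨(1 : Fin 2), (0 : Fin 1)⟩) (i.t₁_eq_s₁ rfl))).symm.trans (hmn.comp _ _ _)
  one₂ f := by
    obtain ⟨χ, rfl, -⟩ := existsUnique_edge f
    obtain ⟨K, O'', i, m, rfl, hm, hmn⟩ := h _ χ
    exact (congrArg n.f2 (hm.one₂ (i.f1 edgeCell))).symm.trans (hmn.one₂ _)
  vcomp α β e := by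
    obtain ⟨χ, ⟨rfl, rfl⟩, -⟩ := existsUnique_vcomp α β e
    obtain ⟨K, O'', i, m, rfl, hm, hmn⟩ := h _ χ
    exact (congrArg n.f2 (hm.vcomp (i.f2 ⟨(0 : Fin 1), (0 : Fin 2)⟩)
      (i.f2 ⟨(0 : Fin 1), (1 : Fin 2)⟩) (i.t₂_eq_s₂ rfl))).symm.trans (hmn.vcomp _ _ _)
  wl f α e := by
    obtain ⟨χ, ⟨rfl, rfl⟩, -⟩ := existsUnique_wl f α e
    obtain ⟨K, O'', i, m, rfl, hm, hmn⟩ := h _ χ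
    exact (congrArg n.f2 (hm.wl (i.f1 ⟨(0 : Fin 2), (0 : Fin 1)⟩)
      (i.f2 ⟨(1 : Fin 2), (0 : Fin 1)⟩) (i.t₁_eq_s₁_s₂ rfl))).symm.trans (hmn.wl _ _ _)
  wr α f e := by
    obtain ⟨χ, ⟨rfl, rfl⟩, -⟩ := existsUnique_wr α f e
    obtain ⟨K, O'', i, m, rfl, hm, hmn⟩ := h _ χ
    exact (congrArg n.f2 (hm.wr (i.f2 ⟨(0 : Fin 2), (0 : Fin 1)⟩)
      (i.f1 ⟨(1 : Fin 2), (0 : Fin 1)⟩) (i.t₁_s₂_eq_s₁ rfl))).symm.trans (hmn.wr _ _ _)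

end cover

end TwoGlob

/-! ### Density of pasting diagrams, and full faithfulness of the nerve -/

namespace TwoGlob

open PastingDiagram

variable {K G : TwoGlob.{u}}

theorem hom_ext_of_diagrams {n n' : K ⟶ G}
    (h : ∀ (P : PastingDiagram 2) (ψ : P.toGlob ⟶ K), ψ ≫ n = ψ ≫ n') : n = n' := by
  refine hom_ext (fun a => ?_) (fun e => ?_) (fun α => ?_)
  · obtain ⟨ψ, rfl, -⟩ := existsUnique_point a
    exact congrFun (congrArg Hom.f0 (h _ ψ) :) pointCell
  · obtain ⟨ψ, rfl, -⟩ := existsUnique_edge e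
    exact congrFun (congrArg Hom.f1 (h _ ψ) :) edgeCell
  · obtain ⟨ψ, rfl, -⟩ := existsUnique_face α
    exact congrFun (congrArg Hom.f2 (h _ ψ) :) faceCell

/-- A natural family of maps between morphisms from pasting diagrams is given by composition. -/
theorem exists_hom_of_diagrams (S : ∀ P : PastingDiagram 2, (P.toGlob ⟶ K) → (P.toGlob ⟶ G))
    (hS : ∀ (P Q : PastingDiagram 2) (m : P.toGlob ⟶ Q.toGlob) (ψ : Q.toGlob ⟶ K),
      S P (m ≫ ψ) = m ≫ S Q ψ) :
    ∃ n : K ⟶ G, ∀ (P : PastingDiagram 2) (ψ : P.toGlob ⟶ K), S P ψ = ψ ≫ n := by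
  choose y0 hy0 uy0 using fun a => existsUnique_point (G := K) a
  choose y1 hy1 uy1 using fun e => existsUnique_edge (G := K) e
  choose y2 hy2 uy2 using fun α => existsUnique_face (G := K) α
  -- Naturality of `S` along the globe that picks out `p` shows that the value of `S P ψ` at `p`
  -- depends only on the cell to which `ψ` sends `p`.
  have n0 (P : PastingDiagram 2) (ψ : P.toGlob ⟶ K) (p) :
      (S P ψ).f0 p = (S _ (y0 (ψ.f0 p))).f0 pointCell := by
    obtain ⟨m, rfl, -⟩ := existsUnique_point p
    rw [← uy0 (ψ.f0 _) (m ≫ ψ) rfl, hS]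
    rfl
  have n1 (P : PastingDiagram 2) (ψ : P.toGlob ⟶ K) (p) :
      (S P ψ).f1 p = (S _ (y1 (ψ.f1 p))).f1 edgeCell := by
    obtain ⟨m, rfl, -⟩ := existsUnique_edge p
    rw [← uy1 (ψ.f1 _) (m ≫ ψ) rfl, hS]
    rfl
  have n2 (P : PastingDiagram 2) (ψ : P.toGlob ⟶ K) (p) :
      (S P ψ).f2 p = (S _ (y2 (ψ.f2 p))).f2 faceCell := by
    obtain ⟨m, rfl, -⟩ := existsUnique_face p
    rw [← uy2 (ψ.f2 _) (m ≫ ψ) rfl, hS]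
    rfl
  let n : Hom K G :=
    { f0 := fun a => (S _ (y0 a)).f0 pointCell
      f1 := fun e => (S _ (y1 e)).f1 edgeCell
      f2 := fun α => (S _ (y2 α)).f2 faceCell
      s₁_f1 := fun e => by rw [(S _ (y1 e)).s₁_f1, n0, ← (y1 e).s₁_f1, hy1]
      t₁_f1 := fun e => by rw [(S _ (y1 e)).t₁_f1, n0, ← (y1 e).t₁_f1, hy1]
      s₂_f2 := fun α => by rw [(S _ (y2 α)).s₂_f2, n1, ← (y2 α).s₂_f2, hy2]
      t₂_f2 := fun α => by rw [(S _ (y2 α)).t₂_f2, n1, ← (y2 α).t₂_f2, hy2] }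
  exact ⟨n, fun P ψ => hom_ext (n0 P ψ) (n1 P ψ) (n2 P ψ)⟩

theorem lift_comp {X : TwoGlob.{u}} {C D : TwoCat.{u}} (m : X ⟶ TwoCat.forget.obj C) (F : C ⟶ D) :
    lift (m ≫ TwoCat.forget.map F) = lift m ≫ F :=
  free_hom_ext (by rw [inclusion_lift, Functor.map_comp, inclusion_lift_assoc])

theorem lift_precomp {X Y : TwoGlob.{u}} {C : TwoCat.{u}} (n : X ⟶ Y)
    (m : Y ⟶ TwoCat.forget.obj C) : lift (n ≫ m) = free.map n ≫ lift m :=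
  free_hom_ext (by simp [inclusion_naturality_assoc])

end TwoGlob

open TwoGlob Opposite

/-- A diagram `ψ` in the cells of `C` is the 2-functor `lift ψ`, an element of the nerve, so the
nerve sees what a 2-functor does to every cell. -/
theorem twoNerve_faithful : twoNerve.{u}.Faithful where
  map_injective {C D F F'} h := TwoCat.forget.map_injective <| hom_ext_of_diagrams fun P ψ => by
    have key : lift ψ ≫ F = lift ψ ≫ F' :=
      ConcreteCategory.congr_hom (NatTrans.congr_app h (op P)) (lift ψ)
    rw [← inclusion_lift ψ, Category.assoc, Category.assoc, ← Functor.map_comp, key,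
      Functor.map_comp]

/-- Evaluating `α` at the 2-functors `lift ψ` gives a natural family on diagrams, hence a globular
map `n`. It preserves the operations because its restriction along each `lift χ` underlies a
2-functor. -/
theorem twoNerve_full : twoNerve.{u}.Full where
  map_surjective {C D} α := by
    let A (P : PastingDiagram 2) (F : free.obj P.toGlob ⟶ C) : free.obj P.toGlob ⟶ D :=
      α.app (op P) F
    have hA (P Q : PastingDiagram 2) (F : free.obj P.toGlob ⟶ free.obj Q.toGlob)
        (F' : free.obj Q.toGlob ⟶ C) : A P (F ≫ F') = F ≫ A Q F' :=
      NatTrans.naturality_apply α (X := op Q) (Y := op P) (Quiver.Hom.op (InducedCategory.homMk F)) F'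
    obtain ⟨n, hn⟩ := exists_hom_of_diagrams
      (fun P (ψ : P.toGlob ⟶ TwoCat.forget.obj C) =>
        P.toGlob.inclusion ≫ TwoCat.forget.map (A P (lift ψ)))
      (fun P Q m ψ => by
        rw [lift_precomp, hA, Functor.map_comp, inclusion_naturality_assoc])
    -- Beyond the generators, `n` computes `α` on every cell of the free 2-category: here naturality
    -- of `α` is used for all 2-functors, not only for those induced by globular maps.
    have key (P : PastingDiagram 2) (F : free.obj P.toGlob ⟶ C) :
        TwoCat.forget.map F ≫ n = TwoCat.forget.map (A P F) :=
      hom_ext_of_diagrams fun Q ψ => by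
        rw [← Category.assoc, ← hn, lift_comp, hA, Functor.map_comp, inclusion_lift_assoc]
    obtain ⟨F, hF⟩ : ∃ F : C ⟶ D, TwoCat.forget.map F = n :=
      TwoCat.exists_functor_of_isHom n <| Ops.isHom_of_cover n fun P χ =>
        ⟨_, (free.obj P.toGlob).ops, P.toGlob.inclusion, TwoCat.forget.map (lift χ),
          inclusion_lift χ, TwoCat.isHom_forget_map _,
          (TwoCat.isHom_forget_map (A P (lift χ))).congr (key P (lift χ)).symm⟩
    refine ⟨F, ?_⟩
    ext ⟨P⟩ x
    exact TwoCat.forget.map_injective ((TwoCat.forget.map_comp x F).trans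
      ((congrArg (TwoCat.forget.map x ≫ ·) hF).trans (key P x)))

theorem fpdInclusion_isDense : fpdInclusion.{u}.IsDense := by
  have := twoNerve_full.{u}
  have := twoNerve_faithful.{u}
  -- The criterion for density concerns the restricted Yoneda functor with a universe lift, which is
  -- the nerve followed by a fully faithful functor.
  have e : twoNerve.{u} ⋙ (Functor.whiskeringRight _ _ _).obj uliftFunctor.{u} ≅
      Presheaf.restrictedULiftYoneda.{u} fpdInclusion.{u} := Iso.refl _
  exact Functor.IsDense.of_fullyFaithful_restrictedULiftYoneda.{u}
    (((Functor.FullyFaithful.ofFullyFaithful twoNerve.{u}).comp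
      (Functor.FullyFaithful.whiskeringRight fullyFaithfulULiftFunctor _)).ofIso e)

/-! ### The 2-category of an arity algebra -/

namespace TwoGlob

open PastingDiagram

/-- The values in `G` of the cells of free 2-categories on pasting diagrams in `G`, like those in
an algebra for the free 2-category monad. -/
structure ArityAlgebra (G : TwoGlob.{u}) where
  act {P : PastingDiagram 2} (χ : P.toGlob ⟶ G) : TwoCat.forget.obj (free.obj P.toGlob) ⟶ G
  inclusion_act {P : PastingDiagram 2} (χ : P.toGlob ⟶ G) : P.toGlob.inclusion ≫ act χ = χ
  act_act {P Q : PastingDiagram 2} (ψ : P.toGlob ⟶ TwoCat.forget.obj (free.obj Q.toGlob))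
    (χ : Q.toGlob ⟶ G) : act (ψ ≫ act χ) = TwoCat.forget.map (lift ψ) ≫ act χ

namespace ArityAlgebra

variable {G : TwoGlob.{u}} (A : G.ArityAlgebra)

theorem act_f0 {P : PastingDiagram 2} (χ : P.toGlob ⟶ G) (p) :
    (A.act χ).f0 (P.toGlob.inclusion.f0 p) = χ.f0 p :=
  congrFun (congrArg Hom.f0 (A.inclusion_act χ) :) p

theorem act_f1 {P : PastingDiagram 2} (χ : P.toGlob ⟶ G) (p) :
    (A.act χ).f1 (P.toGlob.inclusion.f1 p) = χ.f1 p :=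
  congrFun (congrArg Hom.f1 (A.inclusion_act χ) :) p

theorem act_f2 {P : PastingDiagram 2} (χ : P.toGlob ⟶ G) (p) :
    (A.act χ).f2 (P.toGlob.inclusion.f2 p) = χ.f2 p :=
  congrFun (congrArg Hom.f2 (A.inclusion_act χ) :) p

/-- The identity of a 0-cell. -/
noncomputable def one (a : G.C0) : G.C1 :=
  (A.act (existsUnique_point a).choose).f1
    ((free.obj _).ops.one ((toGlob _).inclusion.f0 pointCell))

/-- Composition of 1-cells. -/
noncomputable def comp (f g : G.C1) (h : G.t₁ f = G.s₁ g) : G.C1 :=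
  (A.act (existsUnique_comp f g h).choose).f1
    ((free.obj _).ops.comp ((toGlob _).inclusion.f1 ⟨(0 : Fin 2), (0 : Fin 1)⟩)
      ((toGlob _).inclusion.f1 ⟨(1 : Fin 2), (0 : Fin 1)⟩) rfl)

/-- The identity of a 1-cell. -/
noncomputable def one₂ (f : G.C1) : G.C2 :=
  (A.act (existsUnique_edge f).choose).f2
    ((free.obj _).ops.one₂ ((toGlob _).inclusion.f1 edgeCell))

/-- Vertical composition of 2-cells. -/
noncomputable def vcomp (α β : G.C2) (h : G.t₂ α = G.s₂ β) : G.C2 :=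
  (A.act (existsUnique_vcomp α β h).choose).f2
    ((free.obj _).ops.vcomp ((toGlob _).inclusion.f2 ⟨(0 : Fin 1), (0 : Fin 2)⟩)
      ((toGlob _).inclusion.f2 ⟨(0 : Fin 1), (1 : Fin 2)⟩) rfl)

/-- Whiskering on the left. -/
noncomputable def wl (f : G.C1) (α : G.C2) (h : G.t₁ f = G.s₁ (G.s₂ α)) : G.C2 :=
  (A.act (existsUnique_wl f α h).choose).f2
    ((free.obj _).ops.wl ((toGlob _).inclusion.f1 ⟨(0 : Fin 2), (0 : Fin 1)⟩)
      ((toGlob _).inclusion.f2 ⟨(1 : Fin 2), (0 : Fin 1)⟩) rfl)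

/-- Whiskering on the right. -/
noncomputable def wr (α : G.C2) (f : G.C1) (h : G.t₁ (G.s₂ α) = G.s₁ f) : G.C2 :=
  (A.act (existsUnique_wr α f h).choose).f2
    ((free.obj _).ops.wr ((toGlob _).inclusion.f2 ⟨(0 : Fin 2), (0 : Fin 1)⟩)
      ((toGlob _).inclusion.f1 ⟨(1 : Fin 2), (0 : Fin 1)⟩) rfl)

section act

variable {Q : PastingDiagram 2} (χ : Q.toGlob ⟶ G)

theorem lift_f0 {P : PastingDiagram 2}
    (ψ : P.toGlob ⟶ TwoCat.forget.obj (free.obj Q.toGlob)) (p) :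
    (TwoCat.forget.map (lift ψ)).f0 (P.toGlob.inclusion.f0 p) = ψ.f0 p :=
  congrFun (congrArg Hom.f0 (inclusion_lift ψ) :) p

theorem lift_f1 {P : PastingDiagram 2}
    (ψ : P.toGlob ⟶ TwoCat.forget.obj (free.obj Q.toGlob)) (p) :
    (TwoCat.forget.map (lift ψ)).f1 (P.toGlob.inclusion.f1 p) = ψ.f1 p :=
  congrFun (congrArg Hom.f1 (inclusion_lift ψ) :) p

theorem lift_f2 {P : PastingDiagram 2}
    (ψ : P.toGlob ⟶ TwoCat.forget.obj (free.obj Q.toGlob)) (p) :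
    (TwoCat.forget.map (lift ψ)).f2 (P.toGlob.inclusion.f2 p) = ψ.f2 p :=
  congrFun (congrArg Hom.f2 (inclusion_lift ψ) :) p

/-- The argument in the free 2-category is a diagram `ψ`, and by uniqueness `ψ ≫ A.act χ` is the
diagram chosen in the definition of `one`. Then `act_act` replaces its action by the 2-functor `lift
ψ`, which preserves the operation. The other five operations are treated in the same way. -/
theorem act_one (a) :
    (A.act χ).f1 ((free.obj Q.toGlob).ops.one a) =
      A.one ((A.act χ).f0 a) := by
  obtain ⟨ψ, ha, -⟩ := existsUnique_point (G := TwoCat.forget.obj (free.obj Q.toGlob))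
    a
  have e := (existsUnique_point ((A.act χ).f0 a)).choose_spec.2
    (ψ ≫ A.act χ) (congrArg (A.act χ).f0 ha)
  unfold one
  rw [← e, A.act_act]
  refine congrArg (A.act χ).f1
    (Eq.symm (((TwoCat.isHom_forget_map (lift ψ)).one _).trans ?_))
  exact congrArg (free.obj Q.toGlob).ops.one ((lift_f0 ψ _).trans ha)

theorem act_comp (f g h) :
    (A.act χ).f1 ((free.obj Q.toGlob).ops.comp f g h) =
      A.comp ((A.act χ).f1 f) ((A.act χ).f1 g) ((A.act χ).t₁_eq_s₁ h) := by
  obtain ⟨ψ, ⟨hf, hg⟩, -⟩ := existsUnique_comp (G := TwoCat.forget.obj (free.obj Q.toGlob))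
    f g h
  have e := (existsUnique_comp ((A.act χ).f1 f) ((A.act χ).f1 g) ((A.act χ).t₁_eq_s₁ h)).choose_spec.2
    (ψ ≫ A.act χ) ⟨congrArg (A.act χ).f1 hf, congrArg (A.act χ).f1 hg⟩
  unfold comp
  rw [← e, A.act_act]
  refine congrArg (A.act χ).f1
    (Eq.symm (((TwoCat.isHom_forget_map (lift ψ)).comp _ _ _).trans ?_))
  exact Ops.comp_congr _ ((lift_f1 ψ _).trans hf) ((lift_f1 ψ _).trans hg) _

theorem act_one₂ (f) :
    (A.act χ).f2 ((free.obj Q.toGlob).ops.one₂ f) =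
      A.one₂ ((A.act χ).f1 f) := by
  obtain ⟨ψ, hf, -⟩ := existsUnique_edge (G := TwoCat.forget.obj (free.obj Q.toGlob))
    f
  have e := (existsUnique_edge ((A.act χ).f1 f)).choose_spec.2
    (ψ ≫ A.act χ) (congrArg (A.act χ).f1 hf)
  unfold one₂
  rw [← e, A.act_act]
  refine congrArg (A.act χ).f2
    (Eq.symm (((TwoCat.isHom_forget_map (lift ψ)).one₂ _).trans ?_))
  exact congrArg (free.obj Q.toGlob).ops.one₂ ((lift_f1 ψ _).trans hf)

theorem act_vcomp (α β h) :
    (A.act χ).f2 ((free.obj Q.toGlob).ops.vcomp α β h) =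
      A.vcomp ((A.act χ).f2 α) ((A.act χ).f2 β) ((A.act χ).t₂_eq_s₂ h) := by
  obtain ⟨ψ, ⟨hα, hβ⟩, -⟩ := existsUnique_vcomp (G := TwoCat.forget.obj (free.obj Q.toGlob))
    α β h
  have e := (existsUnique_vcomp ((A.act χ).f2 α) ((A.act χ).f2 β) ((A.act χ).t₂_eq_s₂ h)).choose_spec.2
    (ψ ≫ A.act χ) ⟨congrArg (A.act χ).f2 hα, congrArg (A.act χ).f2 hβ⟩
  unfold vcomp
  rw [← e, A.act_act]
  refine congrArg (A.act χ).f2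
    (Eq.symm (((TwoCat.isHom_forget_map (lift ψ)).vcomp _ _ _).trans ?_))
  exact Ops.vcomp_congr _ ((lift_f2 ψ _).trans hα) ((lift_f2 ψ _).trans hβ) _

theorem act_wl (f α h) :
    (A.act χ).f2 ((free.obj Q.toGlob).ops.wl f α h) =
      A.wl ((A.act χ).f1 f) ((A.act χ).f2 α) ((A.act χ).t₁_eq_s₁_s₂ h) := by
  obtain ⟨ψ, ⟨hf, hα⟩, -⟩ := existsUnique_wl (G := TwoCat.forget.obj (free.obj Q.toGlob))
    f α h
  have e := (existsUnique_wl ((A.act χ).f1 f) ((A.act χ).f2 α) ((A.act χ).t₁_eq_s₁_s₂ h)).choose_spec.2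
    (ψ ≫ A.act χ) ⟨congrArg (A.act χ).f1 hf, congrArg (A.act χ).f2 hα⟩
  unfold wl
  rw [← e, A.act_act]
  refine congrArg (A.act χ).f2
    (Eq.symm (((TwoCat.isHom_forget_map (lift ψ)).wl _ _ _).trans ?_))
  exact Ops.wl_congr _ ((lift_f1 ψ _).trans hf) ((lift_f2 ψ _).trans hα) _

theorem act_wr (α f h) :
    (A.act χ).f2 ((free.obj Q.toGlob).ops.wr α f h) =
      A.wr ((A.act χ).f2 α) ((A.act χ).f1 f) ((A.act χ).t₁_s₂_eq_s₁ h) := by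
  obtain ⟨ψ, ⟨hα, hf⟩, -⟩ := existsUnique_wr (G := TwoCat.forget.obj (free.obj Q.toGlob))
    α f h
  have e := (existsUnique_wr ((A.act χ).f2 α) ((A.act χ).f1 f) ((A.act χ).t₁_s₂_eq_s₁ h)).choose_spec.2
    (ψ ≫ A.act χ) ⟨congrArg (A.act χ).f2 hα, congrArg (A.act χ).f1 hf⟩
  unfold wr
  rw [← e, A.act_act]
  refine congrArg (A.act χ).f2
    (Eq.symm (((TwoCat.isHom_forget_map (lift ψ)).wr _ _ _).trans ?_))
  exact Ops.wr_congr _ ((lift_f2 ψ _).trans hα) ((lift_f1 ψ _).trans hf) _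

end act

/-- The boundary equations inside `ops` need this before `Ops.comp_congr` can be applied to `A`. -/
theorem comp_congr {f f' g g' : G.C1} (hf : f = f') (hg : g = g') (h) :
    A.comp f g h = A.comp f' g' (by rwa [← hf, ← hg]) := by
  subst hf hg
  rfl

/-- The operations of an algebra. -/
noncomputable def ops : G.Ops where
  one := A.one
  comp := A.comp
  one₂ := A.one₂
  vcomp := A.vcomp
  wl := A.wl
  wr := A.wr
  s₁_one a := ((A.act _).s₁_f1 _).trans
    ((A.act_f0 _ _).trans (existsUnique_point a).choose_spec.1)
  t₁_one a := ((A.act _).t₁_f1 _).trans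
    ((A.act_f0 _ _).trans (existsUnique_point a).choose_spec.1)
  s₁_comp f g h := by
    have e := (existsUnique_comp f g h).choose_spec.1
    refine ((A.act _).s₁_f1 _).trans (((A.act _).s₁_f1
      ((ofColumns [[], []]).toGlob.inclusion.f1 ⟨(0 : Fin 2), (0 : Fin 1)⟩)).symm.trans ?_)
    exact congrArg G.s₁ ((A.act_f1 _ _).trans e.1)
  t₁_comp f g h := by
    have e := (existsUnique_comp f g h).choose_spec.1
    refine ((A.act _).t₁_f1 _).trans (((A.act _).t₁_f1
      ((ofColumns [[], []]).toGlob.inclusion.f1 ⟨(1 : Fin 2), (0 : Fin 1)⟩)).symm.trans ?_)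
    exact congrArg G.t₁ ((A.act_f1 _ _).trans e.2)
  s₂_one₂ f := ((A.act _).s₂_f2 _).trans
    ((A.act_f1 _ _).trans (existsUnique_edge f).choose_spec.1)
  t₂_one₂ f := ((A.act _).t₂_f2 _).trans
    ((A.act_f1 _ _).trans (existsUnique_edge f).choose_spec.1)
  s₂_vcomp α β h := by
    have e := (existsUnique_vcomp α β h).choose_spec.1
    refine ((A.act _).s₂_f2 _).trans (((A.act _).s₂_f2
      ((ofColumns [[(), ()]]).toGlob.inclusion.f2 ⟨(0 : Fin 1), (0 : Fin 2)⟩)).symm.trans ?_)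
    exact congrArg G.s₂ ((A.act_f2 _ _).trans e.1)
  t₂_vcomp α β h := by
    have e := (existsUnique_vcomp α β h).choose_spec.1
    refine ((A.act _).t₂_f2 _).trans (((A.act _).t₂_f2
      ((ofColumns [[(), ()]]).toGlob.inclusion.f2 ⟨(0 : Fin 1), (1 : Fin 2)⟩)).symm.trans ?_)
    exact congrArg G.t₂ ((A.act_f2 _ _).trans e.2)
  s₂_wl f α h := by
    have e := (existsUnique_wl f α h).choose_spec.1
    -- The source of a whiskered cell is a composite in the free 2-category on the diagram of `wl`,
    -- whereas `A.comp` is computed from another diagram; `act_comp` compares the two.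
    refine ((A.act _).s₂_f2 _).trans 
      ((congrArg (A.act _).f1 ((free.obj _).ops.s₂_wl _ _ _)).trans ((A.act_comp _ _ _ _).trans ?_))
    exact A.comp_congr ((A.act_f1 _ _).trans e.1)
      (((A.act _).s₂_f2 _).symm.trans (congrArg G.s₂ ((A.act_f2 _ _).trans e.2))) _
  t₂_wl f α h := by
    have e := (existsUnique_wl f α h).choose_spec.1
    refine ((A.act _).t₂_f2 _).trans 
      ((congrArg (A.act _).f1 ((free.obj _).ops.t₂_wl _ _ _)).trans ((A.act_comp _ _ _ _).trans ?_))
    exact A.comp_congr ((A.act_f1 _ _).trans e.1)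
      (((A.act _).t₂_f2 _).symm.trans (congrArg G.t₂ ((A.act_f2 _ _).trans e.2))) _
  s₂_wr α f h := by
    have e := (existsUnique_wr α f h).choose_spec.1
    refine ((A.act _).s₂_f2 _).trans 
      ((congrArg (A.act _).f1 ((free.obj _).ops.s₂_wr _ _ _)).trans ((A.act_comp _ _ _ _).trans ?_))
    exact A.comp_congr
      (((A.act _).s₂_f2 _).symm.trans (congrArg G.s₂ ((A.act_f2 _ _).trans e.1)))
      ((A.act_f1 _ _).trans e.2) _
  t₂_wr α f h := by
    have e := (existsUnique_wr α f h).choose_spec.1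
    refine ((A.act _).t₂_f2 _).trans 
      ((congrArg (A.act _).f1 ((free.obj _).ops.t₂_wr _ _ _)).trans ((A.act_comp _ _ _ _).trans ?_))
    exact A.comp_congr
      (((A.act _).t₂_f2 _).symm.trans (congrArg G.t₂ ((A.act_f2 _ _).trans e.1)))
      ((A.act_f1 _ _).trans e.2) _

theorem isHom_act {Q : PastingDiagram 2} (χ : Q.toGlob ⟶ G) :
    (free.obj Q.toGlob).ops.IsHom A.ops (A.act χ) where
  one := A.act_one χ
  comp := A.act_comp χ
  one₂ := A.act_one₂ χ
  vcomp := A.act_vcomp χ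
  wl := A.act_wl χ
  wr := A.act_wr χ

theorem ops_lawful : A.ops.Lawful :=
  Ops.lawful_of_cover fun _ χ => ⟨_, _, TwoCat.ops_lawful _, _, A.act χ, A.isHom_act χ,
    A.inclusion_act χ⟩

end ArityAlgebra

end TwoGlob

/-! ### The Segal condition -/

open TwoGlob Opposite

theorem exists_globNerve_of_twoNerve {X : Fpd2.{u}ᵒᵖ ⥤ Type u} {C : TwoCat.{u}}
    (e : X ≅ twoNerve.{u}.obj C) : Nonempty (pdToFpd.{u}.op ⋙ X ≅ globNerve.{u}.obj C.glob) := by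
  obtain ⟨adj, -⟩ := exists_adjunction.{u}
  refine ⟨Functor.isoWhiskerLeft pdToFpd.op e ≪≫ NatIso.ofComponents
    (fun P => (adj.homEquiv (PastingDiagram.toGlob (unop P)) C).toIso) fun {P Q} f => ?_⟩
  ext F
  exact adj.homEquiv_naturality_left f.unop.hom F

/-- The isomorphism `φ` identifies elements of `X` with diagrams in `G`; the action of `X` on the
remaining 2-functors, those not induced by globular maps, encodes the composition. -/
theorem exists_twoNerve_of_globNerve {X : Fpd2.{u}ᵒᵖ ⥤ Type u} {G : TwoGlob.{u}}
    (φ : pdToFpd.{u}.op ⋙ X ≅ globNerve.{u}.obj G) :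
    ∃ C : TwoCat.{u}, Nonempty (X ≅ twoNerve.{u}.obj C) := by
  let El (P : PastingDiagram 2) : Type u := X.obj (op P)
  let res {P Q : PastingDiagram 2} (F : free.obj P.toGlob ⟶ free.obj Q.toGlob) : El Q → El P :=
    X.map (X := op Q) (Y := op P) (Quiver.Hom.op (InducedCategory.homMk F))
  have res_id {P : PastingDiagram 2} (x : El P) : res (𝟙 (free.obj P.toGlob)) x = x :=
    ConcreteCategory.congr_hom (X.map_id (op (show Fpd2.{u} from P))) x
  have res_res {P Q R : PastingDiagram 2} (F : free.obj P.toGlob ⟶ free.obj Q.toGlob)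
      (F' : free.obj Q.toGlob ⟶ free.obj R.toGlob) (x : El R) :
      res F (res F' x) = res (F ≫ F') x :=
    (ConcreteCategory.congr_hom (X.map_comp (X := op R) (Y := op Q) (Z := op P)
      (Quiver.Hom.op (InducedCategory.homMk F')) (Quiver.Hom.op (InducedCategory.homMk F))) x).symm
  let seg {P : PastingDiagram 2} (x : El P) : P.toGlob ⟶ G := φ.hom.app (op P) x
  let uns {P : PastingDiagram 2} (χ : P.toGlob ⟶ G) : El P := φ.inv.app (op P) χ
  have seg_uns {P : PastingDiagram 2} (χ : P.toGlob ⟶ G) : seg (uns χ) = χ :=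
    ConcreteCategory.congr_hom (φ.inv_hom_id_app (op P)) χ
  have uns_seg {P : PastingDiagram 2} (x : El P) : uns (seg x) = x :=
    ConcreteCategory.congr_hom (φ.hom_inv_id_app (op P)) x
  have seg_res {P Q : PastingDiagram 2} (m : P.toGlob ⟶ Q.toGlob) (x : El Q) :
      seg (res (free.map m) x) = m ≫ seg x :=
    NatTrans.naturality_apply φ.hom (X := op Q) (Y := op P)
      (Quiver.Hom.op (InducedCategory.homMk m)) x
  -- An element `x` evaluates all cells of the free 2-category on `Q`: a diagram `ψ` of such cells
  -- goes to the diagram in `G` of the restriction of `x` along `lift ψ`. This is natural in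
  -- globular maps, so it is composition with a map `ev Q x`.
  choose ev hev using fun (Q : PastingDiagram 2) (x : El Q) => exists_hom_of_diagrams
    (fun P (ψ : P.toGlob ⟶ TwoCat.forget.obj (free.obj Q.toGlob)) => seg (res (lift ψ) x))
    (fun P P' m ψ => by rw [lift_precomp, ← res_res, seg_res])
  have ev_res {P Q : PastingDiagram 2} (F : free.obj P.toGlob ⟶ free.obj Q.toGlob) (x : El Q) :
      ev P (res F x) = TwoCat.forget.map F ≫ ev Q x :=
    hom_ext_of_diagrams fun R ψ => by
      rw [← hev, res_res, ← lift_comp, hev, Category.assoc]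
  have inclusion_ev {P : PastingDiagram 2} (x : El P) : P.toGlob.inclusion ≫ ev P x = seg x := by
    have e : lift P.toGlob.inclusion = 𝟙 _ := free_hom_ext (by simp)
    rw [← hev, e, res_id]
  let A : G.ArityAlgebra :=
    { act χ := ev _ (uns χ)
      inclusion_act χ := (inclusion_ev _).trans (seg_uns χ)
      act_act ψ χ := by rw [← ev_res, ← hev, uns_seg] }
  have isHom_ev {P : PastingDiagram 2} (x : El P) :
      (free.obj P.toGlob).ops.IsHom A.ops (ev P x) :=
    (A.isHom_act (seg x)).congr (congrArg (ev P) (uns_seg x))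
  let i := A.ops_lawful.globIso
  have exists_functor (P : PastingDiagram 2) (x : El P) :
      ∃ F : free.obj P.toGlob ⟶ A.ops_lawful.toTwoCat, TwoCat.forget.map F = ev P x ≫ i.inv :=
    TwoCat.exists_functor_of_isHom _
      ((isHom_ev x).trans (Ops.IsHom.inv i A.ops_lawful.isHom_globIso_hom))
  -- The evaluation `ev P x` preserves the operations of `A`, so it underlies a 2-functor `D P x` to
  -- the new 2-category; `D` is the comparison from `X` to the nerve.
  choose D hD using exists_functor
  have D_res {P Q : PastingDiagram 2} (F : free.obj P.toGlob ⟶ free.obj Q.toGlob) (x : El Q) :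
      D P (res F x) = F ≫ D Q x :=
    TwoCat.forget.map_injective (by rw [hD, ev_res, Functor.map_comp, hD, Category.assoc])
  -- On the generating cells `D P x` is the diagram `seg x`, up to the isomorphism `i`. This diagram
  -- determines `x` and is arbitrary, while a 2-functor on a free 2-category is determined by its
  -- values on generators.
  have bij (P : PastingDiagram 2) : Function.Bijective (D P) := by
    refine ⟨fun x y h => ?_, fun F => ⟨uns (P.toGlob.inclusion ≫ TwoCat.forget.map F ≫ i.hom), ?_⟩⟩
    · have e : ev P x ≫ i.inv = ev P y ≫ i.inv := by rw [← hD, ← hD, h]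
      rw [← uns_seg x, ← uns_seg y, ← inclusion_ev, ← inclusion_ev, (cancel_mono i.inv).1 e]
    · refine free_hom_ext ?_
      rw [hD, ← Category.assoc, inclusion_ev, seg_uns, Category.assoc, Category.assoc,
        i.hom_inv_id, Category.comp_id]
  refine ⟨A.ops_lawful.toTwoCat, ⟨NatIso.ofComponents
    (fun P => (Equiv.ofBijective _ (bij (unop P))).toIso) fun {Q P} f => ?_⟩⟩
  ext x
  exact D_res f.unop.hom x

theorem mainTheorem3 :
    -- `T` is the free 2-category functor, and the square of `T`, `l`, `i₁`, `i` commutes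
    (∃ adj : TwoGlob.free.{u} ⊣ TwoCat.forget.{u}, ∀ X : TwoGlob.{u},
        adj.unit.app X = X.inclusion) ∧
    pdInclusion.{u} ⋙ TwoGlob.free.{u} = pdToFpd.{u} ⋙ fpdInclusion.{u} ∧
    -- `i` is fully faithful and dense
    fpdInclusion.{u}.Full ∧ fpdInclusion.{u}.Faithful ∧ fpdInclusion.{u}.IsDense ∧
    -- the nerve functor is fully faithful
    twoNerve.{u}.Full ∧ twoNerve.{u}.Faithful ∧
    -- the Segal condition
    ∀ X : Fpd2.{u}ᵒᵖ ⥤ Type u,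
      (∃ C : TwoCat.{u}, Nonempty (X ≅ twoNerve.{u}.obj C)) ↔
        ∃ G : TwoGlob.{u}, Nonempty (pdToFpd.{u}.op ⋙ X ≅ globNerve.{u}.obj G) :=
  -- The square commutes by definition, and `i` is fully faithful as the functor from an induced
  -- category.
  ⟨exists_adjunction, rfl, inferInstance, inferInstance, fpdInclusion_isDense,
    twoNerve_full, twoNerve_faithful, fun _ =>
      ⟨fun ⟨_, ⟨e⟩⟩ => ⟨_, exists_globNerve_of_twoNerve e⟩,
        fun ⟨_, ⟨φ⟩⟩ => exists_twoNerve_of_globNerve φ⟩⟩
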